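/- All graphs are finite and simple. For graphs $H_1,H_2$, let $r(H_1,H_2)$ be the smallest positive integer $N$ such that every graph $F$ on $N$ vertices contains $H_1$ as a (not necessarily induced) subgraph or its complement $\overline F$ contains $H_2$ as a subgraph. Let $P_k$ be the path on $k$ vertices. For a vertex $v$ of a graph $G$, let $G_v$ be the subgraph of $G$ obtained by deleting $v$ and all its neighbours, and let $\alpha'(G)=\min_{v\in V(G)}\alpha(G_v)$, where $\alpha$ denotes the independence number (and $\alpha=0$ for the graph with no vertices). Theorem. Let $k\ge 2$ and $n\ge 3424k^4$ be integers, and let $G$ be a connected graph with $n$ vertices and at most $\left(1+\frac{1}{144k^2}\right)n$ edges. Then $$r(G,P_k)=\max\left\{n+\left\lfloor\frac k2\right\rfloor-1,\; n+k-2-\alpha'(G)-\gamma\right\},$$ where $\gamma=0$ if $k-1$ divides $n+k-3-\alpha'(G)$, and $\gamma=1$ otherwise. -/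

import Mathlib

noncomputable section

namespace SparseRamsey

/-- The set of positive integers `N` such that every graph `F` on `N` vertices contains `H₁` as a
(not necessarily induced) subgraph, or its complement contains `H₂` as a subgraph. -/
def ramseySet {V W : Type*} (H₁ : SimpleGraph V) (H₂ : SimpleGraph W) : Set ℕ :=
  {N | 0 < N ∧ ∀ F : SimpleGraph (Fin N), H₁.IsContained F ∨ H₂.IsContained Fᶜ}

/-- The Ramsey number `r(H₁, H₂)`: the smallest element of `ramseySet H₁ H₂`.
(The junk value of `sInf ∅` is `0`, which is never an element of a `ramseySet`.) -/
def ramseyNumber {V W : Type*} (H₁ : SimpleGraph V) (H₂ : SimpleGraph W) : ℕ :=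
  sInf (ramseySet H₁ H₂)

/-- `G_v`: the subgraph of `G` obtained by deleting `v` and its neighbourhood. -/
def deleteClosedNbhd {V : Type*} (G : SimpleGraph V) (v : V) :
    SimpleGraph {w : V | w ≠ v ∧ ¬ G.Adj v w} :=
  G.induce {w : V | w ≠ v ∧ ¬ G.Adj v w}

/-- `α'(G)`: the minimum over all vertices `v` of the independence number of `G_v`. -/
def alphaPrime {V : Type*} (G : SimpleGraph V) : ℕ :=
  ⨅ v : V, (deleteClosedNbhd G v).indepNum

/-- `γ`, which is `0` if `k - 1` divides `n + k - 3 - a` and `1` otherwise; the arithmetic is that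
of the integers. -/
def gammaTerm (n k a : ℕ) : ℤ :=
  if (k : ℤ) - 1 ∣ (n : ℤ) + k - 3 - a then 0 else 1

end SparseRamsey

end

namespace SparseRamsey
section
open Finset
open scoped Classical

/-! Let H be the complement of the N-vertex host F, assumed to have no path on k vertices, and let h
= ⌊k/2⌋. A copy of G in F is a packing: an injection of V(G) sending edges of G to non-edges of H.

Upper bound. Either H has a vertex w of degree below h, or its minimum degree is at least h. In the
second case a longest path of each component closes into a cycle that must span it
(`PathFree.card_le_of_min_degree`). So components have at most k-1 vertices, all degrees are at most
k-2, and if k-1 does not divide N some vertex has degree at most k-3 (`exists_good_vertex`); this is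
the origin of γ.

The packing is built by induction on |V(G)| in `exists_packing_of_sparse`. A connected graph with
few excess edges has a long suspended path or many leaves
(`CutConnected.exists_isSuspended_or_card_le`). A long suspended path is shortened by one vertex,
the smaller graph is packed, and the image of the path is lengthened again with the help of h spare
vertices (`PathFree.exists_longer`); if that failed, spare and path vertices would interlace into a
k-vertex path of H. When leaves abound (`exists_packing_of_large_reserve`), a vertex c with the most
leaves goes to w, and an independent set of G_c goes onto neighbours of w, so that these vertices,
useless for neighbours of c, are not wasted; this is the role of α'. The remaining non-leaves are
placed on low-degree vertices of H, the remaining leaves by Hall's theorem.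

Lower bound. The disjoint union of cliques on n-1 and h-1 vertices contains no connected graph on n
vertices, and its complement has a side too small for the path. For the other term, F is complete
multipartite with parts of size between t and k-1: the part receiving a vertex c that attains α'
holds at most 1 + α' vertices of G, so at least t-1-α' vertices stay unused. Here t is k-1 or k-2
according to γ. -/

/-- `f 0, …, f (m - 1)` is a path of `H` with `m` vertices, all of them in `U`. -/
structure IsPathOn {W : Type*} (H : SimpleGraph W) (U : Finset W) (m : ℕ) (f : ℕ → W) : Prop where
  mem : ∀ i < m, f i ∈ U
  inj : ∀ i < m, ∀ j < m, f i = f j → i = j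
  adj : ∀ i, i + 1 < m → H.Adj (f i) (f (i + 1))

/-- The graph `H` has no path with `k` vertices. -/
def PathFree {W : Type*} (H : SimpleGraph W) (k : ℕ) : Prop :=
  ∀ (U : Finset W) (f : ℕ → W), ¬ IsPathOn H U k f

/-- The neighbours of `v` inside `U`. -/
noncomputable def nbrs {W : Type*} (H : SimpleGraph W) (U : Finset W) (v : W) : Finset W :=
  U.filter (H.Adj v)

theorem mem_nbrs {W : Type*} {H : SimpleGraph W} {U : Finset W} {v x : W} :
    x ∈ nbrs H U v ↔ x ∈ U ∧ H.Adj v x := by simp [nbrs]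

theorem nbrs_mono {W : Type*} {H : SimpleGraph W} {U U' : Finset W} (h : U ⊆ U') (v : W) :
    nbrs H U v ⊆ nbrs H U' v := Finset.filter_subset_filter _ h

/-! ### Graphs without a k-vertex path -/

section Paths

variable {W : Type*} {H : SimpleGraph W} {U : Finset W} {k m : ℕ} {f : ℕ → W}

theorem IsPathOn.isContained (hf : IsPathOn H U k f) :
    (SimpleGraph.pathGraph k).IsContained H := by
  refine ⟨⟨⟨fun i => f i, ?_⟩, ?_⟩⟩
  · intro a b hab
    rw [SimpleGraph.pathGraph_adj] at hab
    rcases hab with h | h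
    · have := hf.adj a (by omega)
      rwa [h] at this
    · have := hf.adj b (by omega)
      rw [h] at this
      exact this.symm
  · intro a b hab
    exact Fin.ext (hf.inj a a.2 b b.2 hab)

theorem IsPathOn.take {m' : ℕ} (hf : IsPathOn H U m f) (h : m' ≤ m) : IsPathOn H U m' f :=
  ⟨fun i hi => hf.mem i (by omega), fun i hi j hj => hf.inj i (by omega) j (by omega),
    fun i hi => hf.adj i (by omega)⟩

theorem IsPathOn.cons (hf : IsPathOn H U m f) {u : W} (hu : u ∈ U) (hn : ∀ i < m, f i ≠ u)
    (ha : 0 < m → H.Adj u (f 0)) :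
    IsPathOn H U (m + 1) (fun i => Nat.casesOn i u f) := by
  refine ⟨?_, ?_, ?_⟩
  · rintro (_ | i) hi
    · exact hu
    · exact hf.mem i (by omega)
  · rintro (_ | i) hi (_ | j) hj h
    · rfl
    · exact absurd h.symm (hn j (by omega))
    · exact absurd h (hn i (by omega))
    · have := hf.inj i (by omega) j (by omega) h
      omega
  · rintro (_ | i) hi
    · exact ha (by omega)
    · exact hf.adj i (by omega)

theorem IsPathOn.reverse (hf : IsPathOn H U m f) : IsPathOn H U m (fun i => f (m - 1 - i)) := by
  refine ⟨fun i hi => hf.mem _ (by omega), fun i hi j hj h => ?_, fun i hi => ?_⟩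
  · have := hf.inj _ (by omega) _ (by omega) h
    omega
  · have := hf.adj (m - 1 - (i + 1)) (by omega)
    rw [show m - 1 - (i + 1) + 1 = m - 1 - i by omega] at this
    exact this.symm

theorem exists_longest_path (hk : PathFree H k) (hU : U.Nonempty) :
    ∃ m f, 0 < m ∧ m < k ∧ IsPathOn H U m f ∧ ∀ g, ¬ IsPathOn H U (m + 1) g := by
  have hex : ∃ m, ∀ g, ¬ IsPathOn H U m g := ⟨k, fun g => hk U g⟩
  obtain ⟨u, hu⟩ := hU
  have h1 : IsPathOn H U 1 (fun _ => u) :=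
    ⟨fun _ _ => hu, fun i hi j hj _ => by omega, fun i hi => by omega⟩
  have hm := Nat.find_spec hex
  have hle : Nat.find hex ≤ k := Nat.find_le (fun g => hk U g)
  have h2 : 1 < Nat.find hex := by
    by_contra hcon
    exact hm _ (h1.take (by omega))
  have h3 := Nat.find_min hex (m := Nat.find hex - 1) (by omega)
  push Not at h3
  obtain ⟨f, hf⟩ := h3
  refine ⟨Nat.find hex - 1, f, by omega, by omega, hf, ?_⟩
  rw [show Nat.find hex - 1 + 1 = Nat.find hex by omega]
  exact hm

theorem IsPathOn.nbrs_subset_of_longest (hf : IsPathOn H U m f) (hm : 0 < m)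
    (hmax : ∀ g, ¬ IsPathOn H U (m + 1) g) :
    nbrs H U (f 0) ⊆ (Finset.range (m - 1)).image (fun i => f (i + 1)) := by
  intro x hx
  rw [mem_nbrs] at hx
  by_contra hcon
  refine hmax _ (hf.cons hx.1 ?_ (fun _ => hx.2.symm))
  rintro (_ | i) hi h
  · rw [h] at hx
    exact H.loopless.irrefl _ hx.2
  · exact hcon (Finset.mem_image.2 ⟨i, by simp; omega, h⟩)

/-- The end of a longest path inside `U` has all its neighbours in `U` among the other, at most k-2,
path vertices. Hence `H` is (k-2)-degenerate, which yields both the independent sets and the edge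
bound below. -/
theorem PathFree.exists_card_nbrs_le (hk : PathFree H k) (hU : U.Nonempty) :
    ∃ v ∈ U, (nbrs H U v).card ≤ k - 2 := by
  obtain ⟨m, f, hm, hmk, hf, hmax⟩ := exists_longest_path hk hU
  refine ⟨f 0, hf.mem 0 hm, ?_⟩
  have := (Finset.card_le_card (hf.nbrs_subset_of_longest hm hmax)).trans Finset.card_image_le
  rw [Finset.card_range] at this
  omega

theorem PathFree.exists_independent (hk : PathFree H k) (hk2 : 2 ≤ k) (U : Finset W) :
    ∃ I ⊆ U, (∀ x ∈ I, ∀ y ∈ I, ¬ H.Adj x y) ∧ U.card ≤ I.card * (k - 1) := by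
  induction U using Finset.strongInduction with
  | H U ih =>
    rcases U.eq_empty_or_nonempty with rfl | hU
    · exact ⟨∅, by simp, by simp, by simp⟩
    · obtain ⟨v, hv, hd⟩ := hk.exists_card_nbrs_le hU
      obtain ⟨I, hI, hind, hc⟩ := ih (U \ insert v (nbrs H U v))
        ⟨Finset.sdiff_subset, fun h => by simpa using h hv⟩
      have hvI : v ∉ I := fun h => by simpa using hI h
      refine ⟨insert v I, ?_, ?_, ?_⟩
      · exact Finset.insert_subset hv (hI.trans Finset.sdiff_subset)
      · have hvx : ∀ x ∈ I, ¬ H.Adj v x := fun x hx hadj => by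
          have := hI hx
          simp only [Finset.mem_sdiff, Finset.mem_insert, mem_nbrs] at this
          exact this.2 (Or.inr ⟨this.1, hadj⟩)
        intro x hx y hy
        rcases Finset.mem_insert.1 hx with rfl | hx' <;> rcases Finset.mem_insert.1 hy with rfl | hy'
        · exact H.loopless.irrefl _
        · exact hvx y hy'
        · exact fun h => hvx x hx' h.symm
        · exact hind x hx' y hy'
      · have h1 := Finset.le_card_sdiff (insert v (nbrs H U v)) U
        have h2 := Finset.card_insert_le v (nbrs H U v)
        rw [Finset.card_insert_of_notMem hvI, add_mul]
        omega

theorem sum_card_nbrs_insert {v : W} (hv : v ∉ U) :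
    ∑ x ∈ insert v U, (nbrs H (insert v U) x).card =
      ∑ x ∈ U, (nbrs H U x).card + 2 * (nbrs H U v).card := by
  rw [Finset.sum_insert hv]
  have h1 : nbrs H (insert v U) v = nbrs H U v := by
    ext x
    simp only [mem_nbrs, Finset.mem_insert]
    constructor
    · rintro ⟨rfl | h, h'⟩
      · exact absurd h' (H.loopless.irrefl _)
      · exact ⟨h, h'⟩
    · exact fun h => ⟨Or.inr h.1, h.2⟩
  have h2 : ∀ x ∈ U, (nbrs H (insert v U) x).card =
      (nbrs H U x).card + if H.Adj v x then 1 else 0 := by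
    intro x hx
    unfold nbrs
    rw [Finset.filter_insert]
    by_cases h : H.Adj v x
    · rw [if_pos h.symm, if_pos h, Finset.card_insert_of_notMem (by simp [hv])]
    · rw [if_neg (fun h' => h h'.symm), if_neg h, add_zero]
  rw [h1, Finset.sum_congr rfl h2, Finset.sum_add_distrib, ← Finset.card_filter]
  change _ + (_ + (nbrs H U v).card) = _
  ring

theorem PathFree.sum_card_nbrs_le (hk : PathFree H k) (U : Finset W) :
    ∑ x ∈ U, (nbrs H U x).card ≤ 2 * (k - 2) * U.card := by
  induction U using Finset.strongInduction with
  | H U ih =>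
    rcases U.eq_empty_or_nonempty with rfl | hU
    · simp
    · obtain ⟨v, hv, hd⟩ := hk.exists_card_nbrs_le hU
      have h1 := ih (U.erase v) (Finset.erase_ssubset hv)
      have h2 := sum_card_nbrs_insert (H := H) (Finset.notMem_erase v U)
      have h3 := Finset.card_le_card (nbrs_mono (H := H) (Finset.erase_subset v U) v)
      have h4 := Finset.card_erase_add_one hv
      rw [Finset.insert_erase hv] at h2
      rw [h2, ← h4, mul_add]
      nlinarith

/-- The sequence p 0, x 0, p 1, x 1, …, x (h-1), p h is a path on 2h+1 ≥ k vertices. -/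
theorem PathFree.interleave (hk : PathFree H k) {h : ℕ} (hh : k ≤ 2 * h + 1) (p x : ℕ → W)
    (hp : ∀ i ≤ h, ∀ j ≤ h, p i = p j → i = j) (hx : ∀ i < h, ∀ j < h, x i = x j → i = j)
    (hpx : ∀ i ≤ h, ∀ j < h, p i ≠ x j) (h1 : ∀ i < h, H.Adj (p i) (x i))
    (h2 : ∀ i < h, H.Adj (x i) (p (i + 1))) : False := by
  have key : IsPathOn H ((Finset.range (2 * h + 1)).image
      (fun i => if i % 2 = 0 then p (i / 2) else x (i / 2))) (2 * h + 1)
      (fun i => if i % 2 = 0 then p (i / 2) else x (i / 2)) := by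
    refine ⟨fun i hi => Finset.mem_image_of_mem _ (Finset.mem_range.2 hi), ?_, ?_⟩
    · intro i hi j hj hij
      split_ifs at hij with a b b
      · have := hp _ (by omega) _ (by omega) hij
        omega
      · exact absurd hij (hpx _ (by omega) _ (by omega))
      · exact absurd hij.symm (hpx _ (by omega) _ (by omega))
      · have := hx _ (by omega) _ (by omega) hij
        omega
    · intro i hi
      split_ifs with a b b
      · omega
      · rw [show (i + 1) / 2 = i / 2 by omega]
        exact h1 _ (by omega)
      · rw [show (i + 1) / 2 = i / 2 + 1 by omega]
        exact h2 _ (by omega)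
      · omega
  exact hk _ _ (key.take hh)

theorem PathFree.no_biclique (hk : PathFree H k) {h : ℕ} (hh : k ≤ 2 * h + 1) {A Z : Finset W}
    (hA : h + 1 ≤ A.card) (hZ : h ≤ Z.card) (hAZ : ∀ a ∈ A, ∀ z ∈ Z, H.Adj a z) : False := by
  obtain ⟨p, hp⟩ : ∃ p : ℕ → W, (∀ i < A.card, p i ∈ A) ∧
      ∀ i < A.card, ∀ j < A.card, p i = p j → i = j := by
    have hne : A.Nonempty := Finset.card_pos.1 (by omega)
    refine ⟨fun i => if hi : i < A.card then A.equivFin.symm ⟨i, hi⟩ else hne.choose, ?_, ?_⟩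
    · intro i hi
      simp [hi]
    · intro i hi j hj hij
      simpa [hi, hj] using hij
  obtain ⟨x, hx⟩ : ∃ x : ℕ → W, (∀ i < Z.card, x i ∈ Z) ∧
      ∀ i < Z.card, ∀ j < Z.card, x i = x j → i = j := by
    refine ⟨fun i => if hi : i < Z.card then Z.equivFin.symm ⟨i, hi⟩ else p 0, ?_, ?_⟩
    · intro i hi
      simp [hi]
    · intro i hi j hj hij
      simpa [hi, hj] using hij
  refine hk.interleave hh p x (fun i hi j hj => hp.2 i (by omega) j (by omega))
    (fun i hi j hj => hx.2 i (by omega) j (by omega)) (fun i hi j hj h => ?_)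
    (fun i hi => hAZ _ (hp.1 _ (by omega)) _ (hx.1 _ (by omega)))
    (fun i hi => (hAZ _ (hp.1 _ (by omega)) _ (hx.1 _ (by omega))).symm)
  have := hAZ _ (hp.1 i (by omega)) _ (hx.1 j (by omega))
  rw [h] at this
  exact H.loopless.irrefl _ this

/-- Dirac's argument: a longest path in `U` closes into a cycle on its vertices, and if `U` had k or
more vertices, an edge leaving the cycle would give a longer path. -/
theorem PathFree.card_le_of_min_degree (hk : PathFree H k) {h : ℕ} (hh : k ≤ 2 * h + 1)
    (hconn : ∀ A ⊆ U, A.Nonempty → A ≠ U → ∃ a ∈ A, ∃ x ∈ U \ A, H.Adj a x)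
    (hdeg : ∀ v ∈ U, h ≤ (nbrs H U v).card) : U.card ≤ k - 1 := by
  rcases U.eq_empty_or_nonempty with rfl | hU
  · simp
  obtain ⟨m, f, hm, hmk, hf, hmax⟩ := exists_longest_path hk hU
  by_contra hcard
  have hA := hf.nbrs_subset_of_longest hm hmax
  have hB := hf.reverse.nbrs_subset_of_longest hm hmax
  simp only [Nat.sub_zero] at hB
  set A := (Finset.range (m - 1)).filter (fun i => H.Adj (f 0) (f (i + 1))) with hAdef
  set B := (Finset.range (m - 1)).filter (fun i => H.Adj (f (m - 1)) (f i)) with hBdef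
  have hAc : h ≤ A.card := by
    refine (hdeg _ (hf.mem 0 hm)).trans ?_
    refine le_trans (Finset.card_le_card (t := A.image (fun i => f (i + 1))) ?_)
      Finset.card_image_le
    intro x hx
    obtain ⟨i, hi, rfl⟩ := Finset.mem_image.1 (hA hx)
    exact Finset.mem_image.2 ⟨i, Finset.mem_filter.2 ⟨hi, (mem_nbrs.1 hx).2⟩, rfl⟩
  have hBc : h ≤ B.card := by
    refine (hdeg _ (hf.mem (m - 1) (by omega))).trans ?_
    refine le_trans (Finset.card_le_card (t := B.image f) ?_) Finset.card_image_le
    intro x hx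
    obtain ⟨i, hi, rfl⟩ := Finset.mem_image.1 (hB hx)
    rw [Finset.mem_range] at hi
    refine Finset.mem_image.2 ⟨m - 1 - (i + 1), Finset.mem_filter.2
      ⟨Finset.mem_range.2 (by omega), (mem_nbrs.1 hx).2⟩, rfl⟩
  -- Both index sets have at least h elements and lie in a set of m-1 ≤ k-2 < 2h indices.
  have hAB : ∃ i, i ∈ A ∧ i ∈ B := by
    by_contra hcon
    push Not at hcon
    have hdisj : Disjoint A B := Finset.disjoint_left.2 hcon
    have h1 := Finset.card_union_of_disjoint hdisj
    have h2 : (A ∪ B).card ≤ m - 1 := by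
      rw [← Finset.card_range (m - 1)]
      exact Finset.card_le_card
        (Finset.union_subset (Finset.filter_subset _ _) (Finset.filter_subset _ _))
    omega
  obtain ⟨i, hiA, hiB⟩ := hAB
  rw [hAdef, Finset.mem_filter, Finset.mem_range] at hiA
  rw [hBdef, Finset.mem_filter, Finset.mem_range] at hiB
  -- the cycle on the vertices of the longest path
  set g : ℕ → W := fun j => if j ≤ i then f j else f (m + i - j) with hg
  have hgmem : ∀ j < m, g j ∈ U := by
    intro j hj
    simp only [hg]
    split_ifs
    · exact hf.mem _ hj
    · exact hf.mem _ (by omega)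
  have hginj : ∀ a < m, ∀ b < m, g a = g b → a = b := by
    intro a ha b hb hab
    simp only [hg] at hab
    split_ifs at hab <;> have := hf.inj _ (by omega) _ (by omega) hab <;> omega
  have hgadj : ∀ a, a + 1 < m → H.Adj (g a) (g (a + 1)) := by
    intro a ha
    simp only [hg]
    split_ifs with h1 h2 h2
    · exact hf.adj a ha
    · have : a = i := by omega
      subst this
      rw [show m + a - (a + 1) = m - 1 by omega]
      exact hiB.2.symm
    · omega
    · have := hf.adj (m + i - (a + 1)) (by omega)
      rw [show m + i - (a + 1) + 1 = m + i - a by omega] at this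
      exact this.symm
  have hgcl : H.Adj (g (m - 1)) (g 0) := by
    simp only [hg]
    rw [if_neg (by omega), if_pos (by omega), show m + i - (m - 1) = i + 1 by omega]
    exact hiA.2.symm
  have hsub : (Finset.range m).image g ⊆ U := by
    intro x hx
    obtain ⟨j, hj, rfl⟩ := Finset.mem_image.1 hx
    exact hgmem j (Finset.mem_range.1 hj)
  obtain ⟨a, ha, u, hu, hau⟩ := hconn _ hsub
    ⟨g 0, Finset.mem_image_of_mem _ (Finset.mem_range.2 hm)⟩ (by
      intro heq
      have := Finset.card_image_le (s := Finset.range m) (f := g)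
      rw [heq, Finset.card_range] at this
      omega)
  obtain ⟨j, hj, rfl⟩ := Finset.mem_image.1 ha
  rw [Finset.mem_range] at hj
  rw [Finset.mem_sdiff] at hu
  have hmod : ∀ t, (j + t) % m < m := fun t => Nat.mod_lt _ hm
  -- Cut the cycle open at `g j`, the vertex with a neighbour off the cycle.
  have hrot : IsPathOn H U m (fun t => g ((j + t) % m)) := by
    refine ⟨fun t _ => hgmem _ (hmod t), fun s hs t ht hst => ?_, fun t ht => ?_⟩
    · have h1 := hginj _ (hmod s) _ (hmod t) hst
      have h2 : j + s ≡ j + t [MOD m] := h1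
      exact Nat.ModEq.eq_of_lt_of_lt (Nat.ModEq.add_left_cancel' j h2) hs ht
    · have h1 := Nat.div_add_mod (j + t) m
      by_cases h2 : (j + t) % m + 1 < m
      · have h3 : (j + (t + 1)) % m = (j + t) % m + 1 := by
          rw [← add_assoc, Nat.add_mod, Nat.mod_eq_of_lt (a := 1) (by omega), Nat.mod_eq_of_lt h2]
        rw [h3]
        exact hgadj _ h2
      · have h4 : (j + t) % m = m - 1 := by have := hmod t; omega
        have h3 : (j + (t + 1)) % m = 0 := by
          rw [← add_assoc, Nat.add_mod, h4]
          rw [Nat.mod_eq_of_lt (a := 1) (by omega), show m - 1 + 1 = m by omega, Nat.mod_self]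
        rw [h3, h4]
        exact hgcl
  refine hmax _ (hrot.cons hu.1 (fun t ht hcon => ?_) (fun _ => ?_))
  · exact hu.2 (Finset.mem_image.2 ⟨_, Finset.mem_range.2 (hmod t), hcon⟩)
  · rw [add_zero, Nat.mod_eq_of_lt hj]
    exact hau.symm

end Paths

/-! ### Connected graphs with few excess edges: suspended paths or many leaves -/

/-- Every nontrivial cut of `G` is crossed by an edge. -/
def CutConnected {V : Type*} [Fintype V] (G : SimpleGraph V) : Prop :=
  ∀ A : Finset V, A.Nonempty → A ≠ Finset.univ → ∃ a ∈ A, ∃ x, x ∉ A ∧ G.Adj a x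

/-- `p 0, …, p (q - 1)` is a path of `G` whose inner vertices have no further neighbours. -/
structure IsSuspended {V : Type*} (G : SimpleGraph V) (q : ℕ) (p : ℕ → V) : Prop where
  inj : ∀ i < q, ∀ j < q, p i = p j → i = j
  adj : ∀ i, i + 1 < q → G.Adj (p i) (p (i + 1))
  inner : ∀ i, i + 2 < q → ∀ x, G.Adj (p (i + 1)) x → x = p i ∨ x = p (i + 2)

section Sparse

variable {V : Type*} [Fintype V] {G : SimpleGraph V}

theorem cutConnected_of_connected (hG : G.Connected) : CutConnected G := by
  rintro A ⟨a, ha⟩ hA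
  obtain ⟨b, hb⟩ : ∃ b, b ∉ A := by
    by_contra hcon
    push Not at hcon
    exact hA (Finset.eq_univ_iff_forall.2 hcon)
  obtain ⟨w⟩ := hG.preconnected a b
  obtain ⟨d, -, h1, h2⟩ := w.exists_boundary_dart (A : Set V) ha hb
  exact ⟨d.fst, h1, d.snd, h2, d.adj⟩

theorem CutConnected.one_le_degree (hG : CutConnected G) (hV : 2 ≤ Fintype.card V) (v : V) :
    1 ≤ (nbrs G univ v).card := by
  obtain ⟨a, ha, x, hx, hax⟩ := hG {v} ⟨v, by simp⟩ (fun h => by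
    have := congrArg Finset.card h
    rw [Finset.card_singleton, Finset.card_univ] at this
    omega)
  rw [Finset.mem_singleton] at ha
  subst ha
  exact Finset.card_pos.2 ⟨x, mem_nbrs.2 ⟨Finset.mem_univ _, hax⟩⟩

/-- Growing `U` to the whole vertex set one vertex at a time, each new vertex brings at least one
edge. -/
theorem CutConnected.sum_nbrs_add_le (hG : CutConnected G) (U : Finset V) (hU : U.Nonempty) :
    ∑ x ∈ U, (nbrs G U x).card + 2 * (Fintype.card V - U.card) ≤
      ∑ x, (nbrs G univ x).card := by
  induction h : Fintype.card V - U.card generalizing U with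
  | zero =>
    have : U = Finset.univ := by
      rw [← Finset.card_eq_iff_eq_univ]
      have := Finset.card_le_univ U
      omega
    subst this
    simp
  | succ d ih =>
    have hne : U ≠ Finset.univ := by
      rintro rfl
      rw [Finset.card_univ] at h
      omega
    obtain ⟨a, ha, x, hx, hax⟩ := hG U hU hne
    have h1 := ih (insert x U) (Finset.insert_nonempty _ _) (by
      rw [Finset.card_insert_of_notMem hx]
      omega)
    rw [sum_card_nbrs_insert hx] at h1
    have h2 : 0 < (nbrs G U x).card := Finset.card_pos.2 ⟨a, mem_nbrs.2 ⟨ha, hax.symm⟩⟩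
    omega

theorem CutConnected.card_le_of_three_le (hG : CutConnected G) {L : ℕ}
    (hL : ∑ x, (nbrs G univ x).card ≤ 2 * Fintype.card V + 2 * L) (U : Finset V)
    (hU : ∀ v ∈ U, 3 ≤ (nbrs G U v).card) : U.card ≤ 2 * L := by
  rcases U.eq_empty_or_nonempty with rfl | hne
  · simp
  have h1 := hG.sum_nbrs_add_le U hne
  have h2 := Finset.card_nsmul_le_sum U _ 3 hU
  have h3 := Finset.card_le_univ U
  rw [smul_eq_mul] at h2
  omega

/-- The vertices at distance at most `j` from `A`. -/
noncomputable def ballAround (G : SimpleGraph V) (A : Finset V) : ℕ → Finset V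
  | 0 => A
  | j + 1 => ballAround G A j ∪ univ.filter (fun x => ∃ a ∈ ballAround G A j, G.Adj a x)

theorem ballAround_mono (A : Finset V) {i j : ℕ} (h : i ≤ j) :
    ballAround G A i ⊆ ballAround G A j := by
  induction h with
  | refl => exact Finset.Subset.refl _
  | step _ ih => exact ih.trans Finset.subset_union_left

theorem mem_ballAround_succ {A : Finset V} {j : ℕ} {a x : V} (ha : a ∈ ballAround G A j)
    (h : G.Adj a x) : x ∈ ballAround G A (j + 1) :=
  Finset.mem_union_right _ (Finset.mem_filter.2 ⟨Finset.mem_univ _, a, ha, h⟩)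

theorem exists_adj_of_mem_ballAround {A : Finset V} {j : ℕ} {x : V}
    (h : x ∈ ballAround G A (j + 1)) (h' : x ∉ ballAround G A j) :
    ∃ a ∈ ballAround G A j, G.Adj a x := by
  rcases Finset.mem_union.1 h with h | h
  · exact absurd h h'
  · exact (Finset.mem_filter.1 h).2

theorem exists_path_of_mem_ballAround {A : Finset V} (j : ℕ) (v : V)
    (h : v ∈ ballAround G A (j + 1)) (h' : v ∉ ballAround G A j) :
    ∃ f : ℕ → V, f (j + 1) = v ∧ f 0 ∈ A ∧
      (∀ i ≤ j, f (i + 1) ∈ ballAround G A (i + 1) ∧ f (i + 1) ∉ ballAround G A i) ∧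
      ∀ i ≤ j, G.Adj (f i) (f (i + 1)) := by
  induction j generalizing v with
  | zero =>
    obtain ⟨a, ha, hav⟩ := exists_adj_of_mem_ballAround h h'
    refine ⟨fun i => if i = 0 then a else v, by simp, by simpa [ballAround] using ha, ?_, ?_⟩
    · intro i hi
      obtain rfl : i = 0 := by omega
      exact ⟨by simpa using h, by simpa using h'⟩
    · intro i hi
      obtain rfl : i = 0 := by omega
      simpa using hav
  | succ j ih =>
    obtain ⟨a, ha, hav⟩ := exists_adj_of_mem_ballAround h h'
    have ha' : a ∉ ballAround G A j := fun hcon => h' (mem_ballAround_succ hcon hav)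
    obtain ⟨f, hf1, hf0, hf2, hf3⟩ := ih a ha ha'
    refine ⟨Function.update f (j + 2) v, by simp, ?_, ?_, ?_⟩
    · rw [Function.update_of_ne (by omega)]
      exact hf0
    · intro i hi
      rcases Nat.lt_or_ge i (j + 1) with hlt | hge
      · rw [Function.update_of_ne (by omega)]
        exact hf2 i (by omega)
      · obtain rfl : i = j + 1 := by omega
        rw [Function.update_self]
        exact ⟨h, h'⟩
    · intro i hi
      rw [Function.update_of_ne (by omega : i ≠ j + 2)]
      rcases Nat.lt_or_ge i (j + 1) with hlt | hge
      · rw [Function.update_of_ne (by omega)]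
        exact hf3 i (by omega)
      · obtain rfl : i = j + 1 := by omega
        rw [Function.update_self, hf1]
        exact hav

theorem eq_of_adj_of_card_nbrs_eq_two {v a b : V} (hv : (nbrs G univ v).card = 2)
    (ha : G.Adj v a) (hb : G.Adj v b) (hab : a ≠ b) (x : V) (hx : G.Adj v x) :
    x = a ∨ x = b := by
  by_contra hcon
  push Not at hcon
  have h1 : ({x, a, b} : Finset V) ⊆ nbrs G univ v := by
    intro y hy
    simp only [Finset.mem_insert, Finset.mem_singleton] at hy
    rw [mem_nbrs]
    rcases hy with rfl | rfl | rfl <;> simp [*]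
  have h2 := Finset.card_le_card h1
  rw [Finset.card_eq_three.2 ⟨x, a, b, hcon.1, hcon.2, hab, rfl⟩] at h2
  omega

/-- A shortest path from `A` to `v` leaves `A` at once, so its inner vertices have degree two and it
is suspended. -/
theorem exists_isSuspended_of_mem_ballAround {A : Finset V}
    (hA : ∀ v, v ∉ A → (nbrs G univ v).card = 2) (j : ℕ) (v : V)
    (h : v ∈ ballAround G A (j + 1)) (h' : v ∉ ballAround G A j) :
    ∃ p, IsSuspended G (j + 2) p := by
  obtain ⟨f, -, hf0, hf2, hf3⟩ := exists_path_of_mem_ballAround j v h h'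
  have hinj : ∀ a b, a < b → b < j + 2 → f a ≠ f b := by
    intro a b hab hb heq
    obtain ⟨b, rfl⟩ : ∃ c, b = c + 1 := ⟨b - 1, by omega⟩
    apply (hf2 b (by omega)).2
    rw [← heq]
    rcases a with _ | a
    · exact ballAround_mono A (Nat.zero_le b) hf0
    · exact ballAround_mono A (by omega) (hf2 a (by omega)).1
  refine ⟨f, ?_, fun i hi => hf3 i (by omega), ?_⟩
  · intro a ha b hb hab
    rcases lt_trichotomy a b with hlt | heq | hlt
    · exact absurd hab (hinj a b hlt hb)
    · exact heq
    · exact absurd hab.symm (hinj b a hlt ha)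
  · intro i hi x hx
    refine eq_of_adj_of_card_nbrs_eq_two (hA _ (fun hcon => ?_)) (hf3 i (by omega)).symm
      (hf3 (i + 1) (by omega)) (hinj i (i + 2) (by omega) hi) x hx
    exact (hf2 i (by omega)).2 (ballAround_mono A (Nat.zero_le i) hcon)

/-- Outside `A` every vertex has degree two and one neighbour in the previous layer, hence at most
one in the next: layers never grow after the first. -/
theorem card_ballAround_sdiff_le {A : Finset V} (hA : ∀ v, v ∉ A → (nbrs G univ v).card = 2)
    (j : ℕ) : (ballAround G A (j + 1) \ ballAround G A j).card ≤
      ∑ v ∈ A, (nbrs G univ v).card := by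
  induction j with
  | zero =>
    refine le_trans (Finset.card_le_card ?_) Finset.card_biUnion_le
    intro x hx
    rw [Finset.mem_sdiff] at hx
    obtain ⟨a, ha, hax⟩ := exists_adj_of_mem_ballAround hx.1 hx.2
    exact Finset.mem_biUnion.2 ⟨a, ha, mem_nbrs.2 ⟨Finset.mem_univ _, hax⟩⟩
  | succ j ih =>
    refine le_trans ?_ ih
    have hex : ∀ x : V, ∃ a : V, x ∈ ballAround G A (j + 2) \ ballAround G A (j + 1) →
        a ∈ ballAround G A (j + 1) \ ballAround G A j ∧ G.Adj a x := by
      intro x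
      by_cases hx : x ∈ ballAround G A (j + 2) \ ballAround G A (j + 1)
      · rw [Finset.mem_sdiff] at hx
        obtain ⟨a, ha, hax⟩ := exists_adj_of_mem_ballAround hx.1 hx.2
        exact ⟨a, fun _ => ⟨Finset.mem_sdiff.2
          ⟨ha, fun hcon => hx.2 (mem_ballAround_succ hcon hax)⟩, hax⟩⟩
      · exact ⟨x, fun h => absurd h hx⟩
    choose a ha using hex
    refine Finset.card_le_card_of_injOn a (fun x hx => (ha x hx).1) ?_
    intro x hx y hy hxy
    have hax := ha x hx
    have hay := ha y hy
    rw [← hxy] at hay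
    have hmem := Finset.mem_sdiff.1 hax.1
    obtain ⟨b, hb, hba⟩ := exists_adj_of_mem_ballAround hmem.1 hmem.2
    by_contra hne
    have hx2 := (Finset.mem_sdiff.1 hx).2
    have hy2 := (Finset.mem_sdiff.1 hy).2
    rcases eq_of_adj_of_card_nbrs_eq_two
      (hA (a x) (fun hcon => hmem.2 (ballAround_mono A (Nat.zero_le j) hcon)))
      hax.2 hay.2 hne b hba.symm with h | h
    · exact hx2 (h ▸ ballAround_mono A (by omega) hb)
    · exact hy2 (h ▸ ballAround_mono A (by omega) hb)

/-- Layer the graph by distance from the vertices of degree other than two, together with one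
arbitrary vertex that keeps the set nonempty. A nonempty layer q-1 gives a suspended path; otherwise
q-1 layers of bounded size exhaust the graph. -/
theorem CutConnected.exists_isSuspended_or_card_le (hG : CutConnected G)
    (hV : 2 ≤ Fintype.card V) {L q : ℕ} (hq : 2 ≤ q)
    (hL : ∑ x, (nbrs G univ x).card ≤ 2 * Fintype.card V + 2 * L) :
    (∃ p, IsSuspended G q p) ∨ Fintype.card V ≤ (q - 1) *
      (6 * L + 4 * (univ.filter (fun v => (nbrs G univ v).card = 1)).card + 2) := by
  obtain ⟨v₀⟩ : Nonempty V := Fintype.card_pos_iff.1 (by omega)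
  set B := univ.filter (fun v => (nbrs G univ v).card ≠ 2) with hB
  set A := insert v₀ B with hAdef
  have hA : ∀ v, v ∉ A → (nbrs G univ v).card = 2 := by
    intro v hv
    by_contra hcon
    exact hv (Finset.mem_insert_of_mem (Finset.mem_filter.2 ⟨Finset.mem_univ _, hcon⟩))
  have hT : ∑ v ∈ A, (nbrs G univ v).card ≤
      6 * L + 4 * (univ.filter (fun v => (nbrs G univ v).card = 1)).card + 2 := by
    -- Summed from a bound at each vertex of degree d: d·[d ≠ 2] + 6 ≤ 3d + 4·[d = 1].
    have h1 : ∑ v ∈ B, (nbrs G univ v).card + 6 * Fintype.card V ≤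
        3 * ∑ x, (nbrs G univ x).card +
          4 * (univ.filter (fun v => (nbrs G univ v).card = 1)).card := by
      rw [hB, Finset.sum_filter, Finset.card_filter, Finset.mul_sum, Finset.mul_sum,
        ← Finset.sum_add_distrib, ← Finset.card_univ, mul_comm, ← smul_eq_mul,
        ← Finset.sum_const, ← Finset.sum_add_distrib]
      refine Finset.sum_le_sum (fun v _ => ?_)
      have := hG.one_le_degree hV v
      split_ifs <;> omega
    have h2 : ∑ v ∈ A, (nbrs G univ v).card ≤ ∑ v ∈ B, (nbrs G univ v).card + 2 := by
      by_cases hv : v₀ ∈ B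
      · rw [hAdef, Finset.insert_eq_of_mem hv]
        omega
      · rw [hAdef, Finset.sum_insert hv]
        have : (nbrs G univ v₀).card = 2 := by
          by_contra hcon
          exact hv (Finset.mem_filter.2 ⟨Finset.mem_univ _, hcon⟩)
        omega
    omega
  have hAT : A.card ≤ ∑ v ∈ A, (nbrs G univ v).card := by
    rw [Finset.card_eq_sum_ones]
    exact Finset.sum_le_sum (fun v _ => hG.one_le_degree hV v)
  by_cases hj : (ballAround G A (q - 2 + 1) \ ballAround G A (q - 2)).Nonempty
  · obtain ⟨v, hv⟩ := hj
    rw [Finset.mem_sdiff] at hv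
    obtain ⟨p, hp⟩ := exists_isSuspended_of_mem_ballAround hA _ v hv.1 hv.2
    rw [show q - 2 + 2 = q by omega] at hp
    exact Or.inl ⟨p, hp⟩
  · right
    have huniv : ballAround G A (q - 2) = univ := by
      by_contra hcon
      obtain ⟨a, ha, x, hx, hax⟩ := hG _
        ⟨v₀, ballAround_mono A (Nat.zero_le (q - 2)) (Finset.mem_insert_self v₀ B)⟩ hcon
      exact hj ⟨x, Finset.mem_sdiff.2 ⟨mem_ballAround_succ ha hax, hx⟩⟩
    have hcard : ∀ j, (ballAround G A j).card ≤ (j + 1) * ∑ v ∈ A, (nbrs G univ v).card := by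
      intro j
      induction j with
      | zero => simpa [ballAround] using hAT
      | succ j ih =>
        have h1 := card_ballAround_sdiff_le hA j
        have h2 := Finset.card_sdiff_add_card_eq_card (ballAround_mono (G := G) A (Nat.le_succ j))
        simp only [Nat.succ_eq_add_one] at h2
        rw [← h2, add_mul _ 1, one_mul]
        omega
    have h3 := hcard (q - 2)
    rw [huniv, Finset.card_univ, show q - 2 + 1 = q - 1 by omega] at h3
    exact h3.trans (Nat.mul_le_mul_left _ hT)

end Sparse

/-! ### Packings: greedy placement, and Hall's theorem for leaves -/

/-- On `C` the map `φ` is injective and sends edges of `G` to non-edges of `H`. -/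
structure IsPacking {V W : Type*} (G : SimpleGraph V) (H : SimpleGraph W) (C : Finset V)
    (φ : V → W) : Prop where
  inj : ∀ u ∈ C, ∀ v ∈ C, φ u = φ v → u = v
  sep : ∀ u ∈ C, ∀ v ∈ C, G.Adj u v → ¬ H.Adj (φ u) (φ v)

section Packing

variable {V W : Type*} {G : SimpleGraph V} {H : SimpleGraph W} {C : Finset V} {φ : V → W}

theorem IsPacking.insert_update (hφ : IsPacking G H C φ) {v : V} (hv : v ∉ C) {x : W}
    (hx : ∀ u ∈ C, φ u ≠ x) (hadj : ∀ u ∈ C, G.Adj v u → ¬ H.Adj x (φ u)) :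
    IsPacking G H (insert v C) (Function.update φ v x) := by
  have hne : ∀ u ∈ C, u ≠ v := fun u hu h => hv (h ▸ hu)
  constructor
  · intro a ha b hb hab
    rcases Finset.mem_insert.1 ha with rfl | ha' <;> rcases Finset.mem_insert.1 hb with rfl | hb'
    · rfl
    · rw [Function.update_self, Function.update_of_ne (hne b hb')] at hab
      exact absurd hab.symm (hx b hb')
    · rw [Function.update_self, Function.update_of_ne (hne a ha')] at hab
      exact absurd hab (hx a ha')
    · rw [Function.update_of_ne (hne a ha'), Function.update_of_ne (hne b hb')] at hab
      exact hφ.inj a ha' b hb' hab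
  · intro a ha b hb hab
    rcases Finset.mem_insert.1 ha with rfl | ha' <;> rcases Finset.mem_insert.1 hb with rfl | hb'
    · exact absurd hab (G.loopless.irrefl _)
    · rw [Function.update_self, Function.update_of_ne (hne b hb')]
      exact hadj b hb' hab
    · rw [Function.update_self, Function.update_of_ne (hne a ha')]
      exact fun h => hadj a ha' hab.symm h.symm
    · rw [Function.update_of_ne (hne a ha'), Function.update_of_ne (hne b hb')]
      exact hφ.sep a ha' b hb' hab

theorem exists_injOn_of_card_le (φ : V → W) {K : Finset V} {I : Finset W}
    (h : K.card ≤ I.card) : ∃ f : V → W, (∀ v ∈ K, f v ∈ I) ∧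
      (∀ u ∈ K, ∀ v ∈ K, f u = f v → u = v) ∧ ∀ v, v ∉ K → f v = φ v := by
  obtain ⟨e⟩ : Nonempty (K ↪ I) :=
    Function.Embedding.nonempty_of_card_le (by simpa using h)
  refine ⟨fun v => if hv : v ∈ K then e ⟨v, hv⟩ else φ v, ?_, ?_, ?_⟩
  · intro v hv
    simp [hv]
  · intro u hu v hv huv
    simp only [hu, hv, dif_pos] at huv
    simpa using e.injective (Subtype.ext huv)
  · intro v hv
    simp [hv]

variable [Fintype V] [Fintype W]

/-- Outside `Q`, peel off vertices with at most two remaining neighbours and place them greedily in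
reverse order. What is left has minimum degree three, hence at most 2L vertices, and fits into an
independent set of `H`. Avoiding degrees above `D` in `H` keeps the forbidden sets small. -/
theorem exists_packing_extending {k L D : ℕ} (hH : PathFree H k) (hk : 2 ≤ k)
    (hG : CutConnected G) (hL : ∑ x, (nbrs G univ x).card ≤ 2 * Fintype.card V + 2 * L)
    {Q : Finset V} (hQ : IsPacking G H Q φ) (hlow : ∀ u ∈ Q, (nbrs H univ (φ u)).card ≤ D)
    (hcore : 2 * L * (k - 1) + (univ.filter (fun x => D < (nbrs H univ x).card)).card +
      Q.card * (D + 1) ≤ Fintype.card W)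
    (C : Finset V) (hQC : Q ⊆ C)
    (hgreedy : C.card + (univ.filter (fun x => D < (nbrs H univ x).card)).card +
      (Q.card + 2) * D ≤ Fintype.card W) :
    ∃ ψ : V → W, IsPacking G H C ψ ∧ (∀ u ∈ Q, ψ u = φ u) ∧
      ∀ u ∈ C, (nbrs H univ (ψ u)).card ≤ D := by
  set B := univ.filter (fun x => D < (nbrs H univ x).card) with hB
  induction C using Finset.strongInduction with
  | H C ih =>
    by_cases hex : ∃ v ∈ C \ Q, (nbrs G (C \ Q) v).card ≤ 2
    · obtain ⟨v, hv, hd⟩ := hex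
      rw [Finset.mem_sdiff] at hv
      have hc := Finset.card_erase_add_one hv.1
      obtain ⟨ψ, h1, h2, h3⟩ := ih (C.erase v) (Finset.erase_ssubset hv.1)
        (fun u hu => Finset.mem_erase.2 ⟨fun h => hv.2 (h ▸ hu), hQC hu⟩) (by omega)
      set X := (C.erase v).image ψ ∪ B ∪
        (nbrs G (C.erase v) v).biUnion (fun u => nbrs H univ (ψ u)) with hX
      have hnb : (nbrs G (C.erase v) v).card ≤ Q.card + 2 := by
        have : nbrs G (C.erase v) v ⊆ Q ∪ nbrs G (C \ Q) v := by
          intro x hx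
          rw [mem_nbrs, Finset.mem_erase] at hx
          by_cases hxQ : x ∈ Q
          · exact Finset.mem_union_left _ hxQ
          · exact Finset.mem_union_right _
              (mem_nbrs.2 ⟨Finset.mem_sdiff.2 ⟨hx.1.2, hxQ⟩, hx.2⟩)
        have := (Finset.card_le_card this).trans (Finset.card_union_le _ _)
        omega
      have hXc : X.card < Fintype.card W := by
        have e1 : ((nbrs G (C.erase v) v).biUnion (fun u => nbrs H univ (ψ u))).card ≤
            (Q.card + 2) * D :=
          (Finset.card_biUnion_le_card_mul _ _ D (fun u hu => h3 u (mem_nbrs.1 hu).1)).trans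
            (Nat.mul_le_mul_right _ hnb)
        have e2 := Finset.card_image_le (s := C.erase v) (f := ψ)
        have e3 := Finset.card_union_le ((C.erase v).image ψ ∪ B)
          ((nbrs G (C.erase v) v).biUnion (fun u => nbrs H univ (ψ u)))
        have e4 := Finset.card_union_le ((C.erase v).image ψ) B
        rw [← hX] at e3
        omega
      obtain ⟨x, hx⟩ : ∃ x, x ∉ X := by
        by_contra hcon
        push Not at hcon
        rw [Finset.eq_univ_iff_forall.2 hcon, Finset.card_univ] at hXc
        omega
      simp only [hX, Finset.mem_union, not_or, Finset.mem_image, not_exists, not_and,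
        Finset.mem_biUnion, mem_nbrs, Finset.mem_univ, true_and] at hx
      have hpack := h1.insert_update (Finset.notMem_erase v C) hx.1.1
        (fun u hu hvu hxu => hx.2 u ⟨hu, hvu⟩ hxu.symm)
      rw [Finset.insert_erase hv.1] at hpack
      refine ⟨_, hpack, fun u hu => ?_, fun u hu => ?_⟩
      · rw [Function.update_of_ne (by rintro rfl; exact hv.2 hu)]
        exact h2 u hu
      · by_cases huv : u = v
        · subst huv
          rw [Function.update_self]
          have := hx.1.2
          rw [hB, Finset.mem_filter] at this
          simpa using this
        · rw [Function.update_of_ne huv]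
          exact h3 u (Finset.mem_erase.2 ⟨huv, hu⟩)
    · push Not at hex
      have hK := hG.card_le_of_three_le hL (C \ Q) hex
      set X := B ∪ Q.image φ ∪ Q.biUnion (fun u => nbrs H univ (φ u)) with hX
      have hXc : X.card ≤ B.card + Q.card * (D + 1) := by
        have e1 := Finset.card_biUnion_le_card_mul Q (fun u => nbrs H univ (φ u)) D hlow
        have e2 := Finset.card_image_le (s := Q) (f := φ)
        have e3 := Finset.card_union_le (B ∪ Q.image φ) (Q.biUnion (fun u => nbrs H univ (φ u)))
        have e4 := Finset.card_union_le B (Q.image φ)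
        rw [← hX] at e3
        rw [mul_add, mul_one]
        omega
      obtain ⟨I, hIU, hind, hI⟩ := hH.exists_independent hk (univ \ X)
      have hIc : (C \ Q).card ≤ I.card := by
        refine hK.trans (Nat.le_of_mul_le_mul_right (c := k - 1) ?_ (by omega))
        have := Finset.le_card_sdiff X univ
        rw [Finset.card_univ] at this
        omega
      obtain ⟨f, hf1, hf2, hf3⟩ := exists_injOn_of_card_le φ hIc
      have hfX : ∀ v ∈ C \ Q, f v ∉ X := fun v hv => (Finset.mem_sdiff.1 (hIU (hf1 v hv))).2
      simp only [hX, Finset.mem_union, not_or, Finset.mem_image, not_exists, not_and,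
        Finset.mem_biUnion, mem_nbrs, Finset.mem_univ, true_and] at hfX
      have hfQ : ∀ v ∈ Q, f v = φ v := fun v hv =>
        hf3 v (fun h => (Finset.mem_sdiff.1 h).2 hv)
      refine ⟨f, ⟨fun a ha b hb hab => ?_, fun a ha b hb hab => ?_⟩, hfQ, fun u hu => ?_⟩
      · by_cases haQ : a ∈ Q <;> by_cases hbQ : b ∈ Q
        · rw [hfQ a haQ, hfQ b hbQ] at hab
          exact hQ.inj a haQ b hbQ hab
        · rw [hfQ a haQ] at hab
          exact absurd hab ((hfX b (Finset.mem_sdiff.2 ⟨hb, hbQ⟩)).1.2 a haQ)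
        · rw [hfQ b hbQ] at hab
          exact absurd hab.symm ((hfX a (Finset.mem_sdiff.2 ⟨ha, haQ⟩)).1.2 b hbQ)
        · exact hf2 a (Finset.mem_sdiff.2 ⟨ha, haQ⟩) b (Finset.mem_sdiff.2 ⟨hb, hbQ⟩) hab
      · by_cases haQ : a ∈ Q <;> by_cases hbQ : b ∈ Q
        · rw [hfQ a haQ, hfQ b hbQ]
          exact hQ.sep a haQ b hbQ hab
        · rw [hfQ a haQ]
          exact (hfX b (Finset.mem_sdiff.2 ⟨hb, hbQ⟩)).2 a haQ
        · rw [hfQ b hbQ]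
          exact fun h => (hfX a (Finset.mem_sdiff.2 ⟨ha, haQ⟩)).2 b hbQ h.symm
        · exact hind _ (hf1 a (Finset.mem_sdiff.2 ⟨ha, haQ⟩)) _
            (hf1 b (Finset.mem_sdiff.2 ⟨hb, hbQ⟩))
      · by_cases huQ : u ∈ Q
        · rw [hfQ u huQ]
          exact hlow u huQ
        · have := (hfX u (Finset.mem_sdiff.2 ⟨hu, huQ⟩)).1.1
          rw [hB, Finset.mem_filter] at this
          simpa using this

theorem CutConnected.exists_parent (hG : CutConnected G) (hV : 3 ≤ Fintype.card V) :
    ∃ par : V → V, ∀ v, (nbrs G univ v).card = 1 →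
      G.Adj v (par v) ∧ (∀ x, G.Adj v x → x = par v) ∧ (nbrs G univ (par v)).card ≠ 1 := by
  have hex : ∀ v, ∃ a, (nbrs G univ v).card = 1 →
      G.Adj v a ∧ (∀ x, G.Adj v x → x = a) ∧ (nbrs G univ a).card ≠ 1 := by
    intro v
    by_cases hv : (nbrs G univ v).card = 1
    · obtain ⟨a, ha⟩ := Finset.card_eq_one.1 hv
      have ha1 : ∀ x, G.Adj v x ↔ x = a := fun x => by
        have : x ∈ nbrs G univ v ↔ x ∈ ({a} : Finset V) := by rw [ha]
        simpa [mem_nbrs] using this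
      refine ⟨a, fun _ => ⟨(ha1 a).2 rfl, fun x => (ha1 x).1, fun hcon => ?_⟩⟩
      obtain ⟨b, hb⟩ := Finset.card_eq_one.1 hcon
      have hb1 : ∀ x, G.Adj a x ↔ x = b := fun x => by
        have : x ∈ nbrs G univ a ↔ x ∈ ({b} : Finset V) := by rw [hb]
        simpa [mem_nbrs] using this
      have hbv : v = b := (hb1 v).1 ((ha1 a).2 rfl).symm
      obtain ⟨y, hy, x, hx, hyx⟩ := hG {v, a} ⟨v, by simp⟩ (fun h => by
        have h1 := Finset.card_le_two (a := v) (b := a)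
        rw [h, Finset.card_univ] at h1
        omega)
      simp only [Finset.mem_insert, Finset.mem_singleton, not_or] at hy hx
      rcases hy with rfl | rfl
      · exact hx.2 ((ha1 x).1 hyx)
      · exact hx.1 (((hb1 x).1 hyx).trans hbv.symm)
    · exact ⟨v, fun h => absurd h hv⟩
  choose par hpar using hex
  exact ⟨par, hpar⟩

/-- The leaves outside `I` are held back while everything else is placed, which gives the greedy
step its room. The last clause on `I` is vacuous for empty `I`, so vertices of huge degree in `H`
are then allowed. -/
theorem exists_packing_of_large_reserve {k L D h b : ℕ} (hH : PathFree H k) (hk : 2 ≤ k)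
    (hh : k ≤ 2 * h + 1) (hG : CutConnected G) (hV : 3 ≤ Fintype.card V)
    (hL : ∑ x, (nbrs G univ x).card ≤ 2 * Fintype.card V + 2 * L)
    (hspare : Fintype.card V + h ≤ Fintype.card W + 1) (w : W)
    (hw : (nbrs H univ w).card ≤ D)
    (hI : ∀ c, ∃ I : Finset V, (∀ x ∈ I, ∀ y ∈ I, ¬ G.Adj x y) ∧
      (∀ x ∈ I, x ≠ c ∧ ¬ G.Adj c x) ∧ I.card ≤ (nbrs H univ w).card ∧ I.card ≤ b ∧
      (nbrs H univ w).card + Fintype.card V ≤ I.card + Fintype.card W ∧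
      ∀ u ∈ I, ∀ x, (nbrs H univ x).card ≤ D)
    (hcore : 2 * L * (k - 1) + (univ.filter (fun x => D < (nbrs H univ x).card)).card +
      (b + 1) * (D + 1) ≤ Fintype.card W)
    (hgreedy : Fintype.card V + b + (univ.filter (fun x => D < (nbrs H univ x).card)).card +
      (b + 3) * D ≤ Fintype.card W + (univ.filter (fun v => (nbrs G univ v).card = 1)).card)
    (hhall : Fintype.card V + b + (h + 1) * D ≤
      Fintype.card W + (univ.filter (fun v => (nbrs G univ v).card = 1)).card) :
    ∃ ψ : V → W, IsPacking G H univ ψ := by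
  obtain ⟨par, hpar⟩ := hG.exists_parent hV
  set Lf := univ.filter (fun v => (nbrs G univ v).card = 1) with hLf
  have hmemLf : ∀ {v}, v ∈ Lf ↔ (nbrs G univ v).card = 1 := by simp [hLf]
  obtain ⟨v₀⟩ : Nonempty V := Fintype.card_pos_iff.1 (by omega)
  -- `c` is a vertex with as many leaves as possible
  obtain ⟨c, -, hc⟩ := Finset.exists_max_image univ
    (fun a => (Lf.filter (fun v => par v = a)).card) ⟨v₀, Finset.mem_univ _⟩
  have hcLf : c ∉ Lf := by
    intro hcon
    have h1 := hc (par c) (Finset.mem_univ _)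
    have h2 : 0 < (Lf.filter (fun v => par v = par c)).card :=
      Finset.card_pos.2 ⟨c, Finset.mem_filter.2 ⟨hcon, rfl⟩⟩
    obtain ⟨x, hx⟩ := Finset.card_pos.1 (lt_of_lt_of_le h2 h1)
    rw [Finset.mem_filter, hmemLf] at hx
    exact (hpar x hx.1).2.2 (hx.2 ▸ hmemLf.1 hcon)
  obtain ⟨I, hind, hIc, hIw, hIb, hIs, hIlow⟩ := hI c
  obtain ⟨φ, hφ1, hφ2, hφ3⟩ := exists_injOn_of_card_le (fun _ => w) hIw
  have hcI : c ∉ I := fun hcon => (hIc c hcon).1 rfl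
  have hφc : φ c = w := hφ3 c hcI
  have hQcard : (insert c I).card ≤ b + 1 := (Finset.card_insert_le _ _).trans (by omega)
  have hQ : IsPacking G H (insert c I) φ := by
    have hadjw : ∀ u ∈ I, H.Adj w (φ u) := fun u hu => (mem_nbrs.1 (hφ1 u hu)).2
    constructor
    · intro a ha b hb hab
      rcases Finset.mem_insert.1 ha with rfl | ha' <;> rcases Finset.mem_insert.1 hb with rfl | hb'
      · rfl
      · exact absurd (hφc.symm.trans hab) (hadjw b hb').ne
      · exact absurd (hφc.symm.trans hab.symm) (hadjw a ha').ne
      · exact hφ2 a ha' b hb' hab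
    · intro a ha b hb hab
      rcases Finset.mem_insert.1 ha with rfl | ha' <;> rcases Finset.mem_insert.1 hb with rfl | hb'
      · exact absurd hab (G.loopless.irrefl _)
      · exact absurd hab (hIc b hb').2
      · exact absurd hab.symm (hIc a ha').2
      · exact absurd hab (hind a ha' b hb')
  have hlow : ∀ u ∈ insert c I, (nbrs H univ (φ u)).card ≤ D := by
    intro u hu
    rcases Finset.mem_insert.1 hu with rfl | hu'
    · rwa [hφc]
    · exact hIlow u hu' _
  set S := Lf \ I with hS
  set C := univ \ S with hC
  have hCc : C.card + S.card = Fintype.card V := by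
    rw [hC, ← Finset.card_univ]
    exact Finset.card_sdiff_add_card_eq_card (Finset.subset_univ _)
  have hSc : Lf.card ≤ S.card + b := by
    have := Finset.le_card_sdiff I Lf
    rw [← hS] at this
    omega
  have hmemC : ∀ {v}, v ∈ C ↔ v ∉ S := by simp [hC]
  have hQC : insert c I ⊆ C := by
    intro u hu
    rw [hmemC, hS, Finset.mem_sdiff]
    rcases Finset.mem_insert.1 hu with rfl | hu'
    · exact fun h => hcLf h.1
    · exact fun h => h.2 hu'
  obtain ⟨ψ, hψ, hψφ, hψlow⟩ := exists_packing_extending hH hk hG hL hQ hlow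
    (le_trans (by gcongr) hcore) C hQC (by
      have : ((insert c I).card + 2) * D ≤ (b + 3) * D := Nat.mul_le_mul_right _ (by omega)
      omega)
  have hSleaf : ∀ v ∈ S, (nbrs G univ v).card = 1 := fun v hv =>
    hmemLf.1 (Finset.mem_sdiff.1 hv).1
  have hparC : ∀ v ∈ S, par v ∈ C := by
    intro v hv
    rw [hmemC, hS, Finset.mem_sdiff, hmemLf]
    exact fun h => (hpar v (hSleaf v hv)).2.2 h.1
  set R := univ \ C.image ψ with hR
  have hRc : R.card + C.card = Fintype.card W := by
    have h1 : (C.image ψ).card = C.card :=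
      Finset.card_image_of_injOn (fun a ha b hb => hψ.inj a ha b hb)
    rw [hR, ← h1, ← Finset.card_univ]
    exact Finset.card_sdiff_add_card_eq_card (Finset.subset_univ _)
  let t : S → Finset W := fun v => R.filter (fun x => ¬ H.Adj (ψ (par v)) x)
  have hall : ∀ A : Finset S, A.card ≤ (A.biUnion t).card := by
    intro A
    by_contra hcon
    push Not at hcon
    have hAS : A.card ≤ S.card := by simpa using Finset.card_le_univ A
    obtain ⟨v₁, hv₁⟩ : A.Nonempty := Finset.card_pos.1 (by omega)
    set Z := R \ A.biUnion t with hZ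
    have hZc : R.card < Z.card + A.card := by
      have := Finset.le_card_sdiff (A.biUnion t) R
      rw [← hZ] at this
      omega
    have hZadj : ∀ z ∈ Z, ∀ v ∈ A, H.Adj (ψ (par v)) z := by
      intro z hz v hv
      rw [hZ, Finset.mem_sdiff] at hz
      by_contra hnot
      exact hz.2 (Finset.mem_biUnion.2 ⟨v, hv, Finset.mem_filter.2 ⟨hz.1, hnot⟩⟩)
    have hZD : Z.card ≤ D := by
      refine le_trans (Finset.card_le_card (fun z hz => ?_)) (hψlow _ (hparC v₁ v₁.2))
      exact mem_nbrs.2 ⟨Finset.mem_univ _, hZadj z hz v₁ hv₁⟩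
    -- If a leaf at `c` occurs in the Hall violator, `Z` and the image of `I` are disjoint sets of
    -- neighbours of `w`, too many by the choice of |I|.
    by_cases hcA : ∃ v ∈ A, par v = c
    · obtain ⟨v, hv, hvc⟩ := hcA
      have hψc : ψ c = w := (hψφ c (Finset.mem_insert_self _ _)).trans hφc
      have h1 : Z ∪ I.image φ ⊆ nbrs H univ w := by
        intro z hz
        rcases Finset.mem_union.1 hz with hz | hz
        · have := hZadj z hz v hv
          rw [hvc, hψc] at this
          exact mem_nbrs.2 ⟨Finset.mem_univ _, this⟩
        · obtain ⟨u, hu, rfl⟩ := Finset.mem_image.1 hz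
          exact hφ1 u hu
      have h2 : Disjoint Z (I.image φ) := by
        rw [Finset.disjoint_left]
        intro z hz hz'
        obtain ⟨u, hu, rfl⟩ := Finset.mem_image.1 hz'
        have hz2 := (Finset.mem_sdiff.1 (Finset.mem_sdiff.1 hz).1).2
        exact hz2 (Finset.mem_image.2 ⟨u, hQC (Finset.mem_insert_of_mem hu),
          hψφ u (Finset.mem_insert_of_mem hu)⟩)
      have h3 := Finset.card_le_card h1
      rw [Finset.card_union_of_disjoint h2,
        Finset.card_image_of_injOn (fun a ha b hb => hφ2 a ha b hb)] at h3
      omega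
    -- Now the leaves at `c` lie in `S` outside `A`, so |Z| is at least h plus their number. As |Z|
    -- ≤ D, every vertex has at most D leaves. Then either more than h parents form a biclique with
    -- `Z`, or |A| ≤ hD and `R` is too small.
    · push Not at hcA
      have hMc : (Lf.filter (fun v => par v = c)).card + A.card ≤ S.card := by
        have h1 : A.card = (A.image (Subtype.val : S → V)).card :=
          (Finset.card_image_of_injective _ Subtype.val_injective).symm
        rw [h1, ← Finset.card_union_of_disjoint]
        · refine Finset.card_le_card (fun x hx => ?_)
          rcases Finset.mem_union.1 hx with hx | hx
          · rw [Finset.mem_filter] at hx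
            refine Finset.mem_sdiff.2 ⟨hx.1, fun hxI => (hIc x hxI).2 ?_⟩
            have := (hpar x (hmemLf.1 hx.1)).1
            rw [hx.2] at this
            exact this.symm
          · obtain ⟨v, -, rfl⟩ := Finset.mem_image.1 hx
            exact v.2
        · rw [Finset.disjoint_left]
          intro x hx hx'
          obtain ⟨v, hv, rfl⟩ := Finset.mem_image.1 hx'
          exact hcA v hv (Finset.mem_filter.1 hx).2
      set P := A.image (fun v : S => ψ (par v)) with hP
      have hAP : A.card ≤ D * P.card := by
        refine Finset.card_le_mul_card_image A D (fun x hx => ?_)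
        obtain ⟨v, hv, rfl⟩ := Finset.mem_image.1 hx
        refine le_trans ?_ (le_trans (hc (par v) (Finset.mem_univ _))
          (by omega : (Lf.filter (fun v => par v = c)).card ≤ D))
        refine Finset.card_le_card_of_injOn (Subtype.val : S → V) (fun u hu => ?_)
          Subtype.val_injective.injOn
        rw [Finset.mem_coe, Finset.mem_filter] at hu
        exact Finset.mem_filter.2 ⟨(Finset.mem_sdiff.1 u.2).1,
          hψ.inj _ (hparC u u.2) _ (hparC v v.2) hu.2⟩
      rcases Nat.lt_or_ge h P.card with hlt | hge
      · refine hH.no_biclique hh (A := P) (Z := Z) hlt (by omega) (fun a ha z hz => ?_)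
        obtain ⟨v, hv, rfl⟩ := Finset.mem_image.1 ha
        exact hZadj z hz v hv
      · have h1 : D * P.card ≤ D * h := Nat.mul_le_mul_left _ hge
        have h2 : (h + 1) * D = D * h + D := by ring
        omega
  obtain ⟨f, hf1, hf2⟩ := (Finset.all_card_le_biUnion_card_iff_exists_injective t).1 hall
  have hfR : ∀ v : S, ∀ u ∈ C, f v ≠ ψ u := fun v u hu heq =>
    (Finset.mem_sdiff.1 (Finset.mem_filter.1 (hf2 v)).1).2 (Finset.mem_image.2 ⟨u, hu, heq.symm⟩)
  have hfadj : ∀ v : S, ∀ u, G.Adj v u → u ∈ C ∧ ¬ H.Adj (f v) (ψ u) := by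
    intro v u hvu
    have hu := (hpar v (hSleaf v v.2)).2.1 u hvu
    subst hu
    exact ⟨hparC v v.2, fun h => (Finset.mem_filter.1 (hf2 v)).2 h.symm⟩
  refine ⟨fun v => if hv : v ∈ S then f ⟨v, hv⟩ else ψ v, ?_, ?_⟩
  · intro a _ b _ hab
    by_cases ha : a ∈ S <;> by_cases hb : b ∈ S
    · simp only [ha, hb, dif_pos] at hab
      simpa using hf1 hab
    · simp only [ha, hb, dif_pos, not_false_eq_true, dif_neg] at hab
      exact absurd hab (hfR _ b (hmemC.2 hb))
    · simp only [ha, hb, dif_pos, not_false_eq_true, dif_neg] at hab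
      exact absurd hab.symm (hfR _ a (hmemC.2 ha))
    · simp only [ha, hb, not_false_eq_true, dif_neg] at hab
      exact hψ.inj a (hmemC.2 ha) b (hmemC.2 hb) hab
  · intro a _ b _ hab
    by_cases ha : a ∈ S <;> by_cases hb : b ∈ S
    · exact absurd hb (hmemC.1 (hfadj ⟨a, ha⟩ b hab).1)
    · simp only [ha, hb, dif_pos, not_false_eq_true, dif_neg]
      exact (hfadj ⟨a, ha⟩ b hab).2
    · simp only [ha, hb, dif_pos, not_false_eq_true, dif_neg]
      exact fun h => (hfadj ⟨b, hb⟩ a hab.symm).2 h.symm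
    · simp only [ha, hb, not_false_eq_true, dif_neg]
      exact hψ.sep a (hmemC.2 ha) b (hmemC.2 hb) hab

end Packing

/-! ### Lengthening a path of non-edges between fixed ends -/

section Lengthen

variable {W : Type*} {H : SimpleGraph W} {k h m : ℕ} {u x : ℕ → W}

/-- `A` and `B` record the adjacency of two spare vertices to four consecutive path vertices.
Without a common neighbour the two patterns alternate and are complementary, which is the excluded
exchange. -/
theorem alternation_aux {A0 A1 A2 A3 B0 B1 B2 B3 : Prop} (n0 : B0 → ¬ A0) (n1 : B1 → ¬ A1)
    (n2 : B2 → ¬ A2) (n3 : B3 → ¬ A3) (a0 : A0 ∨ A1) (a1 : A1 ∨ A2) (a2 : A2 ∨ A3)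
    (b0 : B0 ∨ B1) (b1 : B1 ∨ B2) (b2 : B2 ∨ B3) (c1 : ¬ A0 → ¬ A2 → ¬ B1 → B3)
    (c2 : ¬ B0 → ¬ B2 → ¬ A1 → A3) : False := by
  by_cases h : A0
  · have h1 : B1 := b0.resolve_left (fun hb => n0 hb h)
    have h2 : A2 := a1.resolve_left (n1 h1)
    have h3 : B3 := b2.resolve_left (fun hb => n2 hb h2)
    exact n3 h3 (c2 (fun hb => n0 hb h) (fun hb => n2 hb h2) (n1 h1))
  · have h1 : A1 := a0.resolve_left h
    have h2 : B2 := b1.resolve_left (fun hb => n1 hb h1)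
    have h3 : A3 := a2.resolve_left (n2 h2)
    exact n3 (c1 h (n2 h2) (fun hb => n1 hb h1)) h3

theorem exists_longer_of_insert (hinj : ∀ i < m, ∀ j < m, u i = u j → i = j)
    (hadj : ∀ i, i + 1 < m → ¬ H.Adj (u i) (u (i + 1))) {y : W} (hy : ∀ i < m, u i ≠ y)
    {i : ℕ} (hi : i + 1 < m) (h1 : ¬ H.Adj (u i) y) (h2 : ¬ H.Adj y (u (i + 1))) :
    ∃ u' : ℕ → W, u' 0 = u 0 ∧ u' m = u (m - 1) ∧
      (∀ a < m + 1, ∀ b < m + 1, u' a = u' b → a = b) ∧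
      (∀ a, a + 1 < m + 1 → ¬ H.Adj (u' a) (u' (a + 1))) ∧
      ∀ a < m + 1, (∃ j < m, u' a = u j) ∨ u' a = y := by
  refine ⟨fun t => if t ≤ i then u t else if t = i + 1 then y else u (t - 1), ?_, ?_, ?_, ?_, ?_⟩
  · simp
  · simp only
    rw [if_neg (by omega), if_neg (by omega)]
  · intro a ha b hb hab
    simp only at hab
    split_ifs at hab with c1 c2 c3 c4 c5 c6 c7 c8
    · exact hinj _ (by omega) _ (by omega) hab
    · exact absurd hab (hy _ (by omega))
    · have := hinj _ (by omega) _ (by omega) hab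
      omega
    · exact absurd hab.symm (hy _ (by omega))
    · omega
    · exact absurd hab.symm (hy _ (by omega))
    · have := hinj _ (by omega) _ (by omega) hab
      omega
    · exact absurd hab (hy _ (by omega))
    · have := hinj _ (by omega) _ (by omega) hab
      omega
  · intro a ha
    simp only
    rcases lt_trichotomy a i with hlt | rfl | hgt
    · rw [if_pos (by omega), if_pos (by omega)]
      exact hadj a (by omega)
    · rw [if_pos (by omega), if_neg (by omega), if_pos rfl]
      exact h1
    · rcases Nat.lt_or_ge (i + 1) a with hlt | hge
      · rw [if_neg (by omega), if_neg (by omega), if_neg (by omega), if_neg (by omega),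
          show a + 1 - 1 = a - 1 + 1 by omega]
        exact hadj (a - 1) (by omega)
      · obtain rfl : a = i + 1 := by omega
        rw [if_neg (by omega), if_pos rfl, if_neg (by omega), if_neg (by omega)]
        exact h2
  · intro a ha
    simp only
    split_ifs
    · exact Or.inl ⟨a, by omega, rfl⟩
    · exact Or.inr rfl
    · exact Or.inl ⟨a - 1, by omega, rfl⟩

/-- Rerouting through u i, y, u (i+2), u (i+1), z, u (i+3) gains two vertices; jumping from u c to u
(c+2) loses one. -/
theorem exists_longer_of_exchange (hinj : ∀ i < m, ∀ j < m, u i = u j → i = j)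
    (hadj : ∀ i, i + 1 < m → ¬ H.Adj (u i) (u (i + 1))) {y z : W} (hy : ∀ i < m, u i ≠ y)
    (hz : ∀ i < m, u i ≠ z) (hyz : y ≠ z) {i c : ℕ} (hic : i + 3 ≤ c) (hc : c + 2 < m)
    (hy0 : ¬ H.Adj y (u i)) (hy2 : ¬ H.Adj y (u (i + 2))) (hz1 : ¬ H.Adj z (u (i + 1)))
    (hz3 : ¬ H.Adj z (u (i + 3))) (hcc : ¬ H.Adj (u c) (u (c + 2))) :
    ∃ u' : ℕ → W, u' 0 = u 0 ∧ u' m = u (m - 1) ∧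
      (∀ a < m + 1, ∀ b < m + 1, u' a = u' b → a = b) ∧
      (∀ a, a + 1 < m + 1 → ¬ H.Adj (u' a) (u' (a + 1))) ∧
      ∀ a < m + 1, (∃ j < m, u' a = u j) ∨ u' a = y ∨ u' a = z := by
  set g : ℕ → W := fun t => if t < m then u t else if t = m then y else z with hg
  have hgu : ∀ t < m, g t = u t := fun t ht => by simp [hg, ht]
  have hgy : g m = y := by simp [hg]
  have hgz : g (m + 1) = z := by simp [hg]
  have hginj : ∀ a < m + 2, ∀ b < m + 2, g a = g b → a = b := by
    intro a ha b hb hab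
    simp only [hg] at hab
    split_ifs at hab
    · exact hinj _ (by omega) _ (by omega) hab
    · exact absurd hab (hy _ (by omega))
    · exact absurd hab (hz _ (by omega))
    · exact absurd hab.symm (hy _ (by omega))
    · omega
    · exact absurd hab hyz
    · exact absurd hab.symm (hz _ (by omega))
    · exact absurd hab.symm hyz
    · omega
  obtain ⟨σ, hσ⟩ : ∃ σ : ℕ → ℕ, ∀ t, (t ≤ i ∧ σ t = t) ∨ (t = i + 1 ∧ σ t = m) ∨
      (t = i + 2 ∧ σ t = i + 2) ∨ (t = i + 3 ∧ σ t = i + 1) ∨ (t = i + 4 ∧ σ t = m + 1) ∨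
      (i + 5 ≤ t ∧ t ≤ c + 2 ∧ σ t = t - 2) ∨ (c + 3 ≤ t ∧ σ t = t - 1) := by
    have hex : ∀ t, ∃ s, (t ≤ i ∧ s = t) ∨ (t = i + 1 ∧ s = m) ∨
        (t = i + 2 ∧ s = i + 2) ∨ (t = i + 3 ∧ s = i + 1) ∨ (t = i + 4 ∧ s = m + 1) ∨
        (i + 5 ≤ t ∧ t ≤ c + 2 ∧ s = t - 2) ∨ (c + 3 ≤ t ∧ s = t - 1) := by
      intro t
      obtain h | h | h | h | h | h | h : t ≤ i ∨ t = i + 1 ∨ t = i + 2 ∨ t = i + 3 ∨ t = i + 4 ∨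
        (i + 5 ≤ t ∧ t ≤ c + 2) ∨ c + 3 ≤ t := by omega
      exacts [⟨t, by omega⟩, ⟨m, by omega⟩, ⟨i + 2, by omega⟩, ⟨i + 1, by omega⟩,
        ⟨m + 1, by omega⟩, ⟨t - 2, by omega⟩, ⟨t - 1, by omega⟩]
    exact ⟨fun t => (hex t).choose, fun t => (hex t).choose_spec⟩
  have hσlt : ∀ t < m + 1, σ t < m + 2 := by
    intro t ht
    have := hσ t
    omega
  have hσinj : ∀ a < m + 1, ∀ b < m + 1, σ a = σ b → a = b := by
    intro a ha b hb hab
    have h1 := hσ a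
    have h2 := hσ b
    omega
  have hgσ : ∀ t s, σ t = s → s < m → g (σ t) = u s := by
    rintro t s rfl hs
    exact hgu _ hs
  refine ⟨fun t => g (σ t), ?_, ?_, ?_, ?_, ?_⟩
  · exact hgσ 0 0 (by have := hσ 0; omega) (by omega)
  · exact hgσ m (m - 1) (by have := hσ m; omega) (by omega)
  · exact fun a ha b hb hab => hσinj a ha b hb (hginj _ (hσlt a ha) _ (hσlt b hb) hab)
  · intro a ha
    simp only
    have h1 : g (σ (i + 1)) = y := by
      rw [show σ (i + 1) = m by have := hσ (i + 1); omega, hgy]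
    have h4 : g (σ (i + 4)) = z := by
      rw [show σ (i + 4) = m + 1 by have := hσ (i + 4); omega, hgz]
    have h2 := hgσ (i + 2) (i + 2) (by have := hσ (i + 2); omega) (by omega)
    have h3 := hgσ (i + 3) (i + 1) (by have := hσ (i + 3); omega) (by omega)
    have hle : ∀ t ≤ i, g (σ t) = u t := fun t ht =>
      hgσ t t (by have := hσ t; omega) (by omega)
    have hmid : ∀ t, i + 5 ≤ t → t ≤ c + 2 → g (σ t) = u (t - 2) := fun t ht ht' =>
      hgσ t (t - 2) (by have := hσ t; omega) (by omega)
    have hend : ∀ t, c + 3 ≤ t → t < m + 1 → g (σ t) = u (t - 1) := fun t ht ht' =>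
      hgσ t (t - 1) (by have := hσ t; omega) (by omega)
    rcases Nat.lt_or_ge a i with hlt | hge
    · rw [hle a (by omega), hle (a + 1) (by omega)]
      exact hadj a (by omega)
    rcases Nat.lt_or_ge a (i + 5) with hlt | hge5
    · obtain rfl | rfl | rfl | rfl | rfl :
        a = i ∨ a = i + 1 ∨ a = i + 2 ∨ a = i + 3 ∨ a = i + 4 := by omega
      · rw [hle a le_rfl, h1]
        exact fun h => hy0 h.symm
      · rw [h1, h2]
        exact hy2
      · rw [h2, h3]
        exact fun h => hadj (i + 1) (by omega) h.symm
      · rw [h3, h4]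
        exact fun h => hz1 h.symm
      · rw [h4, hmid (i + 5) le_rfl (by omega)]
        exact hz3
    rcases Nat.lt_or_ge a (c + 2) with hlt | hgec
    · rw [hmid a (by omega) (by omega), hmid (a + 1) (by omega) (by omega),
        show a + 1 - 2 = a - 2 + 1 by omega]
      exact hadj (a - 2) (by omega)
    rcases Nat.lt_or_ge (c + 2) a with hlt | hge'
    · rw [hend a (by omega) (by omega), hend (a + 1) (by omega) (by omega),
        show a + 1 - 1 = a - 1 + 1 by omega]
      exact hadj (a - 1) (by omega)
    · obtain rfl : a = c + 2 := by omega
      rw [hmid (c + 2) (by omega) le_rfl, hend (c + 2 + 1) (by omega) (by omega)]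
      exact hcc
  · intro a ha
    have h0 := hσlt a ha
    rcases lt_trichotomy (σ a) m with hlt | heq | hgt
    · exact Or.inl ⟨σ a, hlt, hgu _ hlt⟩
    · right; left
      simp only [heq, hgy]
    · right; right
      simp only
      rw [show σ a = m + 1 by omega, hgz]

/-- A path in the complement of a graph without `k`-vertex paths that has many vertices can be
extended by one vertex, keeping its ends, with the help of `k / 2` further vertices. -/
theorem PathFree.exists_longer (hH : PathFree H k) (hh : k ≤ 2 * h + 1)
    (hm : 4 * h + 2 * k ≤ m + 1) (hk : 2 ≤ k)
    (hinj : ∀ i < m, ∀ j < m, u i = u j → i = j)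
    (hadj : ∀ i, i + 1 < m → ¬ H.Adj (u i) (u (i + 1)))
    (hx : ∀ i < h, ∀ j < h, x i = x j → i = j) (hux : ∀ i < m, ∀ j < h, u i ≠ x j) :
    ∃ u' : ℕ → W, u' 0 = u 0 ∧ u' m = u (m - 1) ∧
      (∀ a < m + 1, ∀ b < m + 1, u' a = u' b → a = b) ∧
      (∀ a, a + 1 < m + 1 → ¬ H.Adj (u' a) (u' (a + 1))) ∧
      ∀ a < m + 1, (∃ j < m, u' a = u j) ∨ ∃ j < h, u' a = x j := by
  by_cases hA : ∃ i j, i + 1 < m ∧ j < h ∧ ¬ H.Adj (x j) (u i) ∧ ¬ H.Adj (x j) (u (i + 1))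
  · obtain ⟨i, j, hi, hj, h1, h2⟩ := hA
    obtain ⟨u', e1, e2, e3, e4, e5⟩ := exists_longer_of_insert hinj hadj
      (fun i hi => hux i hi j hj) hi (fun h => h1 h.symm) h2
    exact ⟨u', e1, e2, e3, e4, fun a ha => (e5 a ha).imp_right (fun h => ⟨j, hj, h⟩)⟩
  push Not at hA
  have hA' : ∀ i j, i + 1 < m → j < h → H.Adj (x j) (u i) ∨ H.Adj (x j) (u (i + 1)) :=
    fun i j hi hj => or_iff_not_imp_left.2 (hA i j hi hj)
  by_cases hB : ∃ i a b, i + 3 < 4 * h ∧ a < h ∧ b < h ∧ a ≠ b ∧ ¬ H.Adj (x a) (u i) ∧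
      ¬ H.Adj (x a) (u (i + 2)) ∧ ¬ H.Adj (x b) (u (i + 1)) ∧ ¬ H.Adj (x b) (u (i + 3))
  · obtain ⟨i, a, b, hi, ha, hb, hab, h0, h2, h1, h3⟩ := hB
    -- Otherwise every second vertex beyond position 4h gives a k-vertex path of `H`; this uses the
    -- 2k in the length hypothesis.
    obtain ⟨c, hc1, hc2, hcc⟩ : ∃ c, 4 * h ≤ c ∧ c + 2 < m ∧ ¬ H.Adj (u c) (u (c + 2)) := by
      by_contra hcon
      push Not at hcon
      refine hH ((Finset.range k).image (fun t => u (4 * h + 2 * t)))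
        (fun t => u (4 * h + 2 * t)) ⟨fun t ht => ?_, fun s hs t ht hst => ?_, fun t ht => ?_⟩
      · exact Finset.mem_image_of_mem _ (Finset.mem_range.2 ht)
      · have := hinj _ (by omega) _ (by omega) hst
        omega
      · exact hcon (4 * h + 2 * t) (by omega) (by omega)
    obtain ⟨u', e1, e2, e3, e4, e5⟩ := exists_longer_of_exchange hinj hadj
      (fun i hi => hux i hi a ha) (fun i hi => hux i hi b hb)
      (fun h => hab (hx a ha b hb h)) (by omega : i + 3 ≤ c) hc2 h0 h2 h1 h3 hcc
    refine ⟨u', e1, e2, e3, e4, fun t ht => (e5 t ht).imp_right ?_⟩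
    rintro (h | h)
    exacts [⟨a, ha, h⟩, ⟨b, hb, h⟩]
  exfalso
  push Not at hB
  -- `u e` is a common neighbour of `x (i-1)` and `x i` in the window 4i-2, …, 4i+1 (of just one of
  -- them at the two extremes). The windows are disjoint, so these vertices are distinct and
  -- interlace with `x`.
  have hex : ∀ i, ∃ e, i ≤ h → 4 * i ≤ e + 2 ∧ e ≤ 4 * i + 1 ∧ e < 4 * h ∧
      (i < h → H.Adj (x i) (u e)) ∧ (0 < i → H.Adj (x (i - 1)) (u e)) := by
    intro i
    by_cases hih : i ≤ h
    swap
    · exact ⟨0, fun h => absurd h hih⟩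
    rcases Nat.eq_zero_or_pos i with rfl | hi0
    · rcases hA' 0 0 (by omega) (by omega) with h | h
      · exact ⟨0, fun _ => ⟨by omega, by omega, by omega, fun _ => h, fun h => by omega⟩⟩
      · exact ⟨1, fun _ => ⟨by omega, by omega, by omega, fun _ => h, fun h => by omega⟩⟩
    rcases Nat.lt_or_ge i h with hlt | hge
    · by_contra hcon
      push Not at hcon
      obtain ⟨s, rfl⟩ : ∃ s, i = s + 1 := ⟨i - 1, by omega⟩
      have hno : ∀ t < 4, H.Adj (x (s + 1)) (u (4 * s + 2 + t)) →
          ¬ H.Adj (x s) (u (4 * s + 2 + t)) := by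
        intro t ht h1 h2
        exact (hcon (4 * s + 2 + t)).2 (by omega) (by omega) (by omega) (fun _ => h1)
          |>.2 h2
      have n0 := hno 0 (by omega)
      have n1 := hno 1 (by omega)
      have n2 := hno 2 (by omega)
      have n3 := hno 3 (by omega)
      have a0 := hA' (4 * s + 2) s (by omega) (by omega)
      have a1 := hA' (4 * s + 3) s (by omega) (by omega)
      have a2 := hA' (4 * s + 4) s (by omega) (by omega)
      have b0 := hA' (4 * s + 2) (s + 1) (by omega) (by omega)
      have b1 := hA' (4 * s + 3) (s + 1) (by omega) (by omega)
      have b2 := hA' (4 * s + 4) (s + 1) (by omega) (by omega)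
      have c1 := hB (4 * s + 2) s (s + 1) (by omega) (by omega) (by omega) (by omega)
      have c2 := hB (4 * s + 2) (s + 1) s (by omega) (by omega) (by omega) (by omega)
      simp only [add_assoc, Nat.reduceAdd] at n0 n1 n2 n3 a0 a1 a2 b0 b1 b2 c1 c2
      exact alternation_aux n0 n1 n2 n3 a0 a1 a2 b0 b1 b2 c1 c2
    · rcases hA' (4 * h - 2) (h - 1) (by omega) (by omega) with h' | h'
      · refine ⟨4 * h - 2, fun _ => ⟨by omega, by omega, by omega, fun h => by omega, fun _ => ?_⟩⟩
        rwa [show i - 1 = h - 1 by omega]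
      · refine ⟨4 * h - 2 + 1,
          fun _ => ⟨by omega, by omega, by omega, fun h => by omega, fun _ => ?_⟩⟩
        rwa [show i - 1 = h - 1 by omega]
  choose e he using hex
  refine hH.interleave hh (fun i => u (e i)) x (fun i hi j hj hij => ?_) hx
    (fun i hi j hj => ?_) (fun i hi => ?_) (fun i hi => ?_)
  · have h1 := he i hi
    have h2 := he j hj
    have h3 := hinj _ (by omega) _ (by omega) hij
    omega
  · exact hux _ (by have := he i hi; omega) _ hj
  · exact ((he i (by omega)).2.2.2.1 hi).symm
  · exact (he (i + 1) (by omega)).2.2.2.2 (by omega)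

end Lengthen

/-! ### Suppressing a vertex of a suspended path -/

section Suppress

variable {V : Type*} {G : SimpleGraph V} {q : ℕ} {p : ℕ → V}

/-- The graph obtained from `G` by deleting `p 1` and joining `p 0` to `p 2`. -/
def suppress (G : SimpleGraph V) (p : ℕ → V) : SimpleGraph {v : V // v ≠ p 1} where
  Adj a b := a ≠ b ∧ (G.Adj a b ∨ (a.1 = p 0 ∧ b.1 = p 2) ∨ (a.1 = p 2 ∧ b.1 = p 0))
  symm := ⟨by
    rintro a b ⟨h, h' | h' | h'⟩
    · exact ⟨h.symm, Or.inl h'.symm⟩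
    · exact ⟨h.symm, Or.inr (Or.inr h'.symm)⟩
    · exact ⟨h.symm, Or.inr (Or.inl h'.symm)⟩⟩
  loopless := ⟨fun _ h => h.1 rfl⟩

theorem IsSuspended.ne (hp : IsSuspended G q p) {i j : ℕ} (hi : i < q) (hj : j < q) (h : i ≠ j) :
    p i ≠ p j := fun h' => h (hp.inj i hi j hj h')

theorem IsSuspended.adj_one (hp : IsSuspended G q p) (hq : 4 ≤ q) {x : V} (h : G.Adj (p 1) x) :
    x = p 0 ∨ x = p 2 := hp.inner 0 (by omega) x h

theorem IsSuspended.suppress_adj_of_le (hp : IsSuspended G q p) {i : ℕ}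
    (hi : i + 4 < q) {x y : {v : V // v ≠ p 1}} (hx : x.1 = p (i + 3))
    (h : (suppress G p).Adj x y) : y.1 = p (i + 2) ∨ y.1 = p (i + 4) := by
  rcases h.2 with h | h | h
  · rw [hx] at h
    exact hp.inner (i + 2) (by omega) _ h
  · exact absurd (hx.symm.trans h.1) (hp.ne (by omega) (by omega) (by omega))
  · exact absurd (hx.symm.trans h.1) (hp.ne (by omega) (by omega) (by omega))

/-- Take p 3, p 5, …; at most two of these equal `c` or are adjacent to it. -/
theorem IsSuspended.exists_independent (hp : IsSuspended G q p) (hq : 4 ≤ q)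
    (c : {v : V // v ≠ p 1}) :
    ∃ I : Finset {v : V // v ≠ p 1}, (∀ x ∈ I, ∀ y ∈ I, ¬ (suppress G p).Adj x y) ∧
      (∀ x ∈ I, x ≠ c ∧ ¬ (suppress G p).Adj c x) ∧ q ≤ 2 * I.card + 8 := by
  have hne : ∀ j, j < (q - 3) / 2 → p (2 * j + 3) ≠ p 1 := fun j hj =>
    hp.ne (by omega) (by omega) (by omega)
  let y : ℕ → {v : V // v ≠ p 1} := fun j =>
    if hj : j < (q - 3) / 2 then ⟨p (2 * j + 3), hne j hj⟩ else c
  have hy : ∀ j, j < (q - 3) / 2 → (y j).1 = p (2 * j + 3) := by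
    intro j hj
    simp [y, hj]
  set J := (Finset.range ((q - 3) / 2)).filter (fun j =>
    c.1 ≠ p (2 * j + 2) ∧ c.1 ≠ p (2 * j + 3) ∧ c.1 ≠ p (2 * j + 4)) with hJ
  have hJr : ∀ {j}, j ∈ J → j < (q - 3) / 2 := fun hj =>
    Finset.mem_range.1 (Finset.mem_filter.1 hj).1
  have hJc : (q - 3) / 2 ≤ J.card + 2 := by
    have hbad : ((Finset.range ((q - 3) / 2)) \ J).card ≤ 2 := by
      by_cases hc : ∃ t < q, c.1 = p t
      · obtain ⟨t, ht, htc⟩ := hc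
        refine le_trans (Finset.card_le_card (t := {(t - 2) / 2, (t - 3) / 2}) ?_)
          Finset.card_le_two
        intro j hj
        simp only [hJ, Finset.mem_sdiff, Finset.mem_filter, Finset.mem_range, not_and] at hj
        simp only [Finset.mem_insert, Finset.mem_singleton]
        have hj1 := hj.1
        by_contra hcon
        refine hj.2 hj1 ?_ ?_ ?_ <;> rw [htc]
        · exact hp.ne ht (by omega) (by omega)
        · exact hp.ne ht (by omega) (by omega)
        · exact hp.ne ht (by omega) (by omega)
      · push Not at hc
        rw [Finset.sdiff_eq_empty_iff_subset.2]
        · simp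
        · intro j hj
          have hj1 := Finset.mem_range.1 hj
          exact Finset.mem_filter.2 ⟨hj, hc _ (by omega), hc _ (by omega), hc _ (by omega)⟩
    have h1 := Finset.le_card_sdiff J (Finset.range ((q - 3) / 2))
    rw [Finset.card_range] at h1
    omega
  refine ⟨J.image y, ?_, ?_, ?_⟩
  · intro a ha b hb hab
    obtain ⟨i, hi, rfl⟩ := Finset.mem_image.1 ha
    obtain ⟨j, hj, rfl⟩ := Finset.mem_image.1 hb
    have hi' := hJr hi
    have hj' := hJr hj
    rcases hp.suppress_adj_of_le (i := 2 * i) (by omega) (hy i hi') hab with h | h <;>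
      rw [hy j hj'] at h <;> have := hp.inj _ (by omega) _ (by omega) h <;> omega
  · intro a ha
    obtain ⟨i, hi, rfl⟩ := Finset.mem_image.1 ha
    have hi' := hJr hi
    have hc := (Finset.mem_filter.1 hi).2
    refine ⟨fun h => hc.2.1 (h ▸ hy i hi'), fun h => ?_⟩
    rcases hp.suppress_adj_of_le (i := 2 * i) (by omega) (hy i hi') h.symm with h | h
    · exact hc.1 h
    · exact hc.2.2 h
  · rw [Finset.card_image_of_injOn]
    · omega
    · intro i hi j hj hij
      have hi' := hJr hi
      have hj' := hJr hj
      have h := congrArg Subtype.val hij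
      simp only [hy i hi', hy j hj'] at h
      have := hp.inj _ (by omega) _ (by omega) h
      omega

variable [Fintype V]

theorem card_suppress (p : ℕ → V) : Fintype.card {v : V // v ≠ p 1} + 1 = Fintype.card V := by
  have h := Fintype.card_subtype_compl (fun v => v = p 1)
  have h1 : Fintype.card {v : V // v = p 1} = 1 := Fintype.card_subtype_eq _
  have h2 : 0 < Fintype.card V := Fintype.card_pos_iff.2 ⟨p 1⟩
  rw [h1] at h
  change Fintype.card {v : V // ¬ v = p 1} + 1 = _
  omega

theorem IsSuspended.le_card (hp : IsSuspended G q p) : q ≤ Fintype.card V := by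
  rw [← Fintype.card_fin q]
  exact Fintype.card_le_of_injective (fun i : Fin q => p i)
    (fun i j h => Fin.ext (hp.inj i i.2 j j.2 h))

/-- Lift a cut by putting `p 1` on the side of `p 0`. A crossing edge at `p 1` then goes to `p 2`
and becomes the new edge. -/
theorem IsSuspended.cutConnected_suppress (hp : IsSuspended G q p) (hq : 4 ≤ q)
    (hG : CutConnected G) : CutConnected (suppress G p) := by
  intro A hA hAu
  have h01 : p 0 ≠ p 1 := hp.ne (by omega) (by omega) (by omega)
  have h21 : p 2 ≠ p 1 := hp.ne (by omega) (by omega) (by omega)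
  have h02 : p 0 ≠ p 2 := hp.ne (by omega) (by omega) (by omega)
  let P0 : {v : V // v ≠ p 1} := ⟨p 0, h01⟩
  let P2 : {v : V // v ≠ p 1} := ⟨p 2, h21⟩
  have hadj02 : (suppress G p).Adj P0 P2 :=
    ⟨fun h => h02 (congrArg Subtype.val h), Or.inr (Or.inl ⟨rfl, rfl⟩)⟩
  set A' : Finset V := univ.filter (fun v => ∃ a ∈ A, a.1 = v ∨ (v = p 1 ∧ a.1 = p 0)) with hA'
  have hmem : ∀ v, v ∈ A' ↔ ∃ a ∈ A, a.1 = v ∨ (v = p 1 ∧ a.1 = p 0) := by simp [hA']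
  have hmem1 : p 1 ∈ A' ↔ P0 ∈ A := by
    rw [hmem]
    constructor
    · rintro ⟨a, ha, h | h⟩
      · exact absurd h a.2
      · rwa [show P0 = a from Subtype.ext h.2.symm]
    · exact fun h => ⟨P0, h, Or.inr ⟨rfl, rfl⟩⟩
  have hmem2 : ∀ v (hv : v ≠ p 1), v ∈ A' ↔ (⟨v, hv⟩ : {v : V // v ≠ p 1}) ∈ A := by
    intro v hv
    rw [hmem]
    constructor
    · rintro ⟨a, ha, h | h⟩
      · subst h
        exact ha
      · exact absurd h.1 hv
    · exact fun h => ⟨_, h, Or.inl rfl⟩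
  obtain ⟨a₀, ha₀⟩ := hA
  obtain ⟨a, ha, x, hx, hax⟩ := hG A' ⟨a₀.1, (hmem _).2 ⟨a₀, ha₀, Or.inl rfl⟩⟩ (fun h => by
    apply hAu
    rw [Finset.eq_univ_iff_forall]
    intro y
    have : y.1 ∈ A' := by rw [h]; exact Finset.mem_univ _
    exact (hmem2 y.1 y.2).1 this)
  by_cases h1 : a = p 1
  · subst h1
    have hP0 := hmem1.1 ha
    rcases hp.adj_one hq hax with rfl | rfl
    · exact absurd ((hmem2 _ h01).2 hP0) hx
    · exact ⟨P0, hP0, P2, fun h => hx ((hmem2 _ h21).2 h), hadj02⟩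
  · by_cases h2 : x = p 1
    · subst h2
      have hP0 : P0 ∉ A := fun h => hx (hmem1.2 h)
      rcases hp.adj_one hq hax.symm with rfl | rfl
      · exact absurd ((hmem2 _ h01).1 ha) hP0
      · exact ⟨P2, (hmem2 _ h21).1 ha, P0, hP0, hadj02.symm⟩
    · refine ⟨⟨a, h1⟩, (hmem2 a h1).1 ha, ⟨x, h2⟩, fun h => hx ((hmem2 x h2).2 h), ?_, Or.inl hax⟩
      exact fun h => hax.ne (congrArg Subtype.val h)

theorem IsSuspended.card_nbrs_suppress_le (hp : IsSuspended G q p) (hq : 4 ≤ q)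
    (v : {v : V // v ≠ p 1}) :
    (nbrs (suppress G p) univ v).card ≤ (nbrs G univ v.1).card := by
  have h02 : p 0 ≠ p 2 := hp.ne (by omega) (by omega) (by omega)
  refine Finset.card_le_card_of_injOn (fun x => if G.Adj v x.1 then x.1 else p 1) ?_ ?_
  · intro x hx
    have hx' := (mem_nbrs.1 hx).2.2
    refine mem_nbrs.2 ⟨Finset.mem_univ _, ?_⟩
    simp only
    split_ifs with h
    · exact h
    · rcases hx' with h' | h' | h'
      · exact absurd h' h
      · rw [h'.1]
        exact hp.adj 0 (by omega)
      · rw [h'.1]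
        exact (hp.adj 1 (by omega)).symm
  · intro x hx y hy hxy
    have hx' := (mem_nbrs.1 hx).2.2
    have hy' := (mem_nbrs.1 hy).2.2
    simp only at hxy
    split_ifs at hxy with h1 h2 h2
    · exact Subtype.ext hxy
    · exact absurd hxy x.2
    · exact absurd hxy.symm y.2
    · rcases hx'.resolve_left h1 with h3 | h3 <;> rcases hy'.resolve_left h2 with h4 | h4
      · exact Subtype.ext (h3.2.trans h4.2.symm)
      · exact absurd (h3.1.symm.trans h4.1) h02
      · exact absurd (h4.1.symm.trans h3.1) h02
      · exact Subtype.ext (h3.2.trans h4.2.symm)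

theorem IsSuspended.sum_nbrs_suppress_le (hp : IsSuspended G q p) (hq : 4 ≤ q) :
    ∑ v, (nbrs (suppress G p) univ v).card + 2 ≤ ∑ v, (nbrs G univ v).card := by
  have h1 : 2 ≤ (nbrs G univ (p 1)).card := by
    rw [← Finset.card_pair (hp.ne (by omega) (by omega) (by omega) : p 0 ≠ p 2)]
    refine Finset.card_le_card (fun x hx => ?_)
    rw [mem_nbrs]
    rcases Finset.mem_insert.1 hx with rfl | hx
    · exact ⟨Finset.mem_univ _, (hp.adj 0 (by omega)).symm⟩
    · rw [Finset.mem_singleton.1 hx]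
      exact ⟨Finset.mem_univ _, hp.adj 1 (by omega)⟩
  have h2 := Finset.sum_le_sum (s := univ) (fun v _ => hp.card_nbrs_suppress_le hq v)
  have h3 : ∑ v : {v : V // v ≠ p 1}, (nbrs G univ v.1).card =
      ∑ v ∈ univ.erase (p 1), (nbrs G univ v).card :=
    (Finset.sum_subtype (univ.erase (p 1)) (by simp) (fun v => (nbrs G univ v).card)).symm
  have h4 := Finset.sum_erase_add univ (fun v => (nbrs G univ v).card) (Finset.mem_univ (p 1))
  omega

/-- Only the ends of the suspended path have neighbours off it, so its image may be exchanged for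
any path of non-edges with the same ends that avoids the other images. -/
theorem IsSuspended.exists_packing_of_suppress {W : Type*} [Fintype W] {H : SimpleGraph W}
    {k h : ℕ} (hH : PathFree H k) (hk : 2 ≤ k) (hh : k ≤ 2 * h + 1) (hp : IsSuspended G q p)
    (hq : 4 * h + 2 * k ≤ q) (h0 : 0 < h) (hspare : Fintype.card V + h ≤ Fintype.card W + 1)
    {φ : {v : V // v ≠ p 1} → W} (hφ : IsPacking (suppress G p) H univ φ) :
    ∃ ψ : V → W, IsPacking G H univ ψ := by
  have hinjφ : ∀ a b, φ a = φ b → a = b := fun a b =>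
    hφ.inj a (Finset.mem_univ _) b (Finset.mem_univ _)
  have hsepφ : ∀ a b, (suppress G p).Adj a b → ¬ H.Adj (φ a) (φ b) := fun a b =>
    hφ.sep a (Finset.mem_univ _) b (Finset.mem_univ _)
  have h01 : p 0 ≠ p 1 := hp.ne (by omega) (by omega) (by omega)
  -- vertices of `W` outside the image
  obtain ⟨x, hxφ, hxinj⟩ : ∃ x : ℕ → W, (∀ j < h, ∀ v, φ v ≠ x j) ∧
      ∀ i < h, ∀ j < h, x i = x j → i = j := by
    have hc : (Finset.range h).card ≤ (univ \ univ.image φ).card := by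
      have h1 := Finset.le_card_sdiff (univ.image φ) univ
      have h2 := Finset.card_image_le (s := univ) (f := φ)
      have h3 := card_suppress p
      rw [Finset.card_univ] at h1 h2
      rw [Finset.card_range]
      omega
    obtain ⟨x, hx1, hx2, -⟩ := exists_injOn_of_card_le (fun _ => φ ⟨p 0, h01⟩) hc
    refine ⟨x, fun j hj v hv => ?_, fun i hi j hj => hx2 i (Finset.mem_range.2 hi) j
      (Finset.mem_range.2 hj)⟩
    exact (Finset.mem_sdiff.1 (hx1 j (Finset.mem_range.2 hj))).2
      (Finset.mem_image.2 ⟨v, Finset.mem_univ _, hv⟩)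
  -- the image of the shortened path
  set s : ℕ → ℕ := fun i => if i = 0 then 0 else i + 1 with hs
  have hs0 : s 0 = 0 := rfl
  have hs1 : ∀ i, 0 < i → s i = i + 1 := fun i hi => if_neg (by omega)
  have hsne : ∀ i, s i ≠ 1 := by
    intro i
    rcases Nat.eq_zero_or_pos i with rfl | hi
    · rw [hs0]
      omega
    · rw [hs1 i hi]
      omega
  have hsinj : ∀ i j, s i = s j → i = j := by
    intro i j hij
    simp only [hs] at hij
    split_ifs at hij <;> omega
  have hslt : ∀ i < q - 1, s i < q := by
    intro i hi
    simp only [hs]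
    split_ifs <;> omega
  set φ' : V → W := fun v => if hv : v ≠ p 1 then φ ⟨v, hv⟩ else φ ⟨p 0, h01⟩ with hφ'
  have hφ'eq : ∀ v (hv : v ≠ p 1), φ' v = φ ⟨v, hv⟩ := fun v hv => dif_pos hv
  have hφ'x : ∀ j < h, ∀ v, φ' v ≠ x j := by
    intro j hj v
    simp only [hφ']
    split_ifs
    · exact hxφ j hj _
    · exact hxφ j hj _
  have hφ'inj : ∀ a b, a ≠ p 1 → b ≠ p 1 → φ' a = φ' b → a = b := by
    intro a b ha hb hab
    rw [hφ'eq a ha, hφ'eq b hb] at hab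
    exact congrArg Subtype.val (hinjφ _ _ hab)
  have hφ'sep : ∀ a b, a ≠ p 1 → b ≠ p 1 → G.Adj a b → ¬ H.Adj (φ' a) (φ' b) := by
    intro a b ha hb hab
    rw [hφ'eq a ha, hφ'eq b hb]
    exact hsepφ _ _ ⟨fun h => hab.ne (congrArg Subtype.val h), Or.inl hab⟩
  have hps : ∀ i < q - 1, p (s i) ≠ p 1 := fun i hi =>
    hp.ne (hslt i hi) (by omega) (hsne i)
  obtain ⟨u', e1, e2, e3, e4, e5⟩ := hH.exists_longer (u := fun i => φ' (p (s i))) (x := x)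
    (m := q - 1) hh (by omega) hk
    (fun i hi j hj hij => hsinj i j (hp.inj _ (hslt i hi) _ (hslt j hj)
      (hφ'inj _ _ (hps i hi) (hps j hj) hij)))
    (fun i hi => by
      rcases Nat.eq_zero_or_pos i with rfl | hi0
      · have h2 : p (0 + 1 + 1) ≠ p 1 := hp.ne (by omega) (by omega) (by omega)
        rw [hs0, hs1 (0 + 1) (by omega), hφ'eq _ h01, hφ'eq _ h2]
        refine hsepφ _ _ ⟨fun h => ?_, Or.inr (Or.inl ⟨rfl, rfl⟩)⟩
        exact hp.ne (by omega) (by omega) (by omega) (congrArg Subtype.val h)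
      · have h3 := hps i (by omega)
        have h4 := hps (i + 1) (by omega)
        refine hφ'sep _ _ h3 h4 ?_
        rw [hs1 i hi0, hs1 (i + 1) (by omega)]
        exact hp.adj _ (by omega))
    hxinj (fun i _ j hj => hφ'x j hj _)
  rw [show q - 1 + 1 = q by omega] at e3 e4 e5
  have e1' : u' 0 = φ' (p 0) := by rw [e1, hs0]
  have e2' : u' (q - 1) = φ' (p (q - 1)) := by
    rw [e2, hs1 _ (by omega), show q - 1 - 1 + 1 = q - 1 by omega]
  obtain ⟨ψ, hψ1, hψ2⟩ : ∃ ψ : V → W, (∀ i < q, ψ (p i) = u' i) ∧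
      ∀ v, (∀ i < q, p i ≠ v) → ψ v = φ' v := by
    refine ⟨fun v => if hv : ∃ i < q, p i = v then u' hv.choose else φ' v, fun i hi => ?_,
      fun v hv => ?_⟩
    · have hex : ∃ j < q, p j = p i := ⟨i, hi, rfl⟩
      simp only
      rw [dif_pos hex, hp.inj _ hex.choose_spec.1 _ hi hex.choose_spec.2]
    · refine dif_neg ?_
      push Not
      exact hv
  have hoff : ∀ v, (∀ i < q, p i ≠ v) → ∀ i < q, u' i ≠ φ' v := by
    intro v hv i hi heq
    rcases e5 i hi with ⟨j, hj, h'⟩ | ⟨j, hj, h'⟩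
    · exact hv _ (hslt j hj) (hφ'inj _ _ (hps j hj) (hv 1 (by omega)).symm (h'.symm.trans heq))
    · exact hφ'x j hj v (heq.symm.trans h')
  -- an edge of `G` leaving a vertex of the path
  have hedge : ∀ i < q, ∀ v, G.Adj (p i) v →
      (i + 1 < q ∧ v = p (i + 1)) ∨ (0 < i ∧ v = p (i - 1)) ∨ i = 0 ∨ i = q - 1 := by
    intro i hi v hv
    rcases Nat.eq_zero_or_pos i with rfl | hi0
    · exact Or.inr (Or.inr (Or.inl rfl))
    · rcases Nat.lt_or_ge (i + 1) q with hlt | hge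
      · obtain ⟨j, rfl⟩ : ∃ j, i = j + 1 := ⟨i - 1, by omega⟩
        rcases hp.inner j (by omega) v hv with h | h
        · exact Or.inr (Or.inl ⟨by omega, h⟩)
        · exact Or.inl ⟨hlt, h⟩
      · exact Or.inr (Or.inr (Or.inr (by omega)))
  have hend : ∀ i < q, i = 0 ∨ i = q - 1 → u' i = φ' (p i) ∧ p i ≠ p 1 := by
    rintro i hi (rfl | rfl)
    · exact ⟨e1', h01⟩
    · exact ⟨e2', hp.ne hi (by omega) (by omega)⟩
  have hstep : ∀ i < q, ∀ v, G.Adj (p i) v → ¬ (i = 0 ∨ i = q - 1) →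
      ¬ H.Adj (ψ (p i)) (ψ v) := by
    intro i hi v hv hne
    rcases hedge i hi v hv with ⟨h, rfl⟩ | ⟨h, rfl⟩ | h
    · rw [hψ1 i hi, hψ1 _ h]
      exact e4 i h
    · rw [hψ1 i hi, hψ1 _ (by omega)]
      have := e4 (i - 1) (by omega)
      rw [show i - 1 + 1 = i by omega] at this
      exact fun h => this h.symm
    · exact absurd h hne
  have hφψ : ∀ v, (∀ i < q, p i = v → i = 0 ∨ i = q - 1) → ψ v = φ' v ∧ v ≠ p 1 := by
    intro v hv
    by_cases hex : ∃ i < q, p i = v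
    · obtain ⟨i, hi, rfl⟩ := hex
      have := hend i hi (hv i hi rfl)
      exact ⟨(hψ1 i hi).trans this.1, this.2⟩
    · push Not at hex
      exact ⟨hψ2 v hex, (hex 1 (by omega)).symm⟩
  refine ⟨ψ, fun a _ b _ hab => ?_, fun a _ b _ hab => ?_⟩
  · by_cases ha : ∃ i < q, p i = a <;> by_cases hb : ∃ i < q, p i = b
    · obtain ⟨i, hi, rfl⟩ := ha
      obtain ⟨j, hj, rfl⟩ := hb
      rw [hψ1 i hi, hψ1 j hj] at hab
      rw [e3 i hi j hj hab]
    · obtain ⟨i, hi, rfl⟩ := ha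
      push Not at hb
      rw [hψ1 i hi, hψ2 b hb] at hab
      exact absurd hab (hoff b hb i hi)
    · obtain ⟨j, hj, rfl⟩ := hb
      push Not at ha
      rw [hψ1 j hj, hψ2 a ha] at hab
      exact absurd hab.symm (hoff a ha j hj)
    · push Not at ha hb
      rw [hψ2 a ha, hψ2 b hb] at hab
      exact hφ'inj _ _ (ha 1 (by omega)).symm (hb 1 (by omega)).symm hab
  · by_cases ha : ∃ i < q, p i = a ∧ ¬ (i = 0 ∨ i = q - 1)
    · obtain ⟨i, hi, rfl, hne⟩ := ha
      exact hstep i hi b hab hne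
    by_cases hb : ∃ i < q, p i = b ∧ ¬ (i = 0 ∨ i = q - 1)
    · obtain ⟨i, hi, rfl, hne⟩ := hb
      exact fun h => hstep i hi a hab.symm hne h.symm
    have ha' := hφψ a (fun i hi hia => by
      by_contra hcon
      exact ha ⟨i, hi, hia, hcon⟩)
    have hb' := hφψ b (fun i hi hib => by
      by_contra hcon
      exact hb ⟨i, hi, hib, hcon⟩)
    rw [ha'.1, hb'.1]
    exact hφ'sep a b ha'.2 hb'.2 hab

end Suppress

/-! ### Arithmetic of the degree threshold -/

section Numerics

theorem card_mul_le_sum_of_lt {W : Type*} [Fintype W] {H : SimpleGraph W} {k : ℕ}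
    (hH : PathFree H k) (D : ℕ) :
    (univ.filter (fun x => D < (nbrs H univ x).card)).card * (D + 1) ≤
      2 * (k - 2) * Fintype.card W := by
  refine le_trans ?_ (Finset.card_univ (α := W) ▸ hH.sum_card_nbrs_le univ)
  refine le_trans ?_ (Finset.sum_le_sum_of_subset (Finset.filter_subset
    (fun x => D < (nbrs H univ x).card) univ))
  rw [← smul_eq_mul]
  exact Finset.card_nsmul_le_sum _ _ _ (fun x hx => (Finset.mem_filter.1 hx).2)

theorem high_degree_bound {N k D β : ℕ} (hk : 2 ≤ k) (hD : N < 36 * k * (k + 2) * (D + 1))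
    (hβ : β * (D + 1) ≤ 2 * (k - 2) * N) : β ≤ 72 * k ^ 3 := by
  obtain ⟨j, rfl⟩ : ∃ j, k = j + 2 := ⟨k - 2, by omega⟩
  rw [Nat.add_sub_cancel] at hβ
  have h1 : β * (D + 1) ≤ (72 * (j * (j + 2) * (j + 4))) * (D + 1) := by
    calc β * (D + 1) ≤ 2 * j * N := hβ
      _ ≤ 2 * j * (36 * (j + 2) * (j + 2 + 2) * (D + 1)) := Nat.mul_le_mul_left _ hD.le
      _ = _ := by ring
  have h2 := Nat.le_of_mul_le_mul_right h1 (Nat.succ_pos D)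
  refine h2.trans (Nat.mul_le_mul_left _ ?_)
  nlinarith [sq_nonneg j]

/-- These are the size conditions of `exists_packing_of_large_reserve` with b = k-1-h. Without a
long suspended path, s + (N-n) is at least about 11N/(192k), while the placement needs about
7N/(288k) plus O(k³). The slack N-n is counted with the leaves because suppression may bring n far
below N. -/
theorem greedy_bound {N n k h L D β s : ℕ} (hk : 2 ≤ k) (hh : k ≤ 2 * h + 1) (hhk : 2 * h ≤ k)
    (hN : 3424 * k ^ 4 ≤ N) (hL : 144 * k ^ 2 * L ≤ N) (hD : 36 * k * (k + 2) * D ≤ N)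
    (hβ : β ≤ 72 * k ^ 3) (hn : n ≤ N) (hs : n ≤ (4 * k - 1) * (6 * L + 4 * s + 2)) :
    2 * L * (k - 1) + β + (k - 1 - h + 1) * (D + 1) ≤ N ∧
      n + (k - 1 - h) + β + (k - 1 - h + 3) * D ≤ N + s ∧
      n + (k - 1 - h) + (h + 1) * D ≤ N + s := by
  obtain ⟨r, rfl⟩ := Nat.exists_eq_add_of_le hn
  obtain ⟨b, hb⟩ : ∃ b, k - 1 - h = b := ⟨_, rfl⟩
  have hb1 : 2 * b ≤ k - 1 := by omega
  have hb2 : b + h + 1 = k := by omega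
  rw [hb]
  have hk3 : 0 < k ^ 3 := by positivity
  have hkk3 : k ≤ k ^ 3 := Nat.le_self_pow (by omega) k
  have hN3 : 3424 * (k ^ 3 * k) ≤ n + r := by rw [← pow_succ]; exact hN
  have hs2 : n ≤ 4 * k * (6 * L + 4 * s + 2) :=
    hs.trans (Nat.mul_le_mul_right _ (Nat.sub_le _ _))
  have hkL : 288 * (k * L) ≤ n + r := by
    refine le_trans ?_ hL
    have : 2 * k ≤ k ^ 2 := by nlinarith
    nlinarith [Nat.mul_le_mul_right L this]
  have hkD : 144 * (k * D) ≤ n + r := by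
    refine le_trans ?_ hD
    have : 4 * (k * D) ≤ (k + 2) * (k * D) := Nat.mul_le_mul_right _ (by omega)
    nlinarith
  have hN4 : 6848 * k ^ 3 ≤ n + r := by nlinarith
  have hres : 11 * (n + r) ≤ 192 * (k * (s + r)) + 96 * k := by
    have : r ≤ k * r := Nat.le_mul_of_pos_left _ (by omega)
    nlinarith
  have key : ∀ t, (b + 3) * D ≤ t → (h + 1) * D ≤ t → 288 * (k * t) ≤ 7 * (n + r) →
      b + β + t ≤ s + r := by
    intro t _ _ ht
    by_contra hcon
    push Not at hcon
    have h1 : k * (s + r) ≤ k * (b + β + t) := Nat.mul_le_mul_left _ hcon.le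
    have h2 : k * (b + β) ≤ k * (73 * k ^ 3) := Nat.mul_le_mul_left _ (by omega)
    have h3 : k * k ^ 3 = k ^ 3 * k := mul_comm _ _
    nlinarith
  have hD7 : ∀ c, 2 * c ≤ k + 5 → 288 * (k * (c * D)) ≤ 7 * (n + r) := by
    intro c hc
    have h1 : 8 * c ≤ 7 * (k + 2) := by omega
    have h2 : (8 * c) * (k * D) ≤ (7 * (k + 2)) * (k * D) := Nat.mul_le_mul_right _ h1
    nlinarith
  have hmax : ∃ t, (b + 3) * D ≤ t ∧ (h + 1) * D ≤ t ∧ 288 * (k * t) ≤ 7 * (n + r) := by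
    rcases le_total (b + 3) (h + 1) with hle | hle
    · exact ⟨_, Nat.mul_le_mul_right _ hle, le_rfl, hD7 _ (by omega)⟩
    · exact ⟨_, le_rfl, Nat.mul_le_mul_right _ hle, hD7 _ (by omega)⟩
  obtain ⟨t, ht1, ht2, ht3⟩ := hmax
  have ht := key t ht1 ht2 ht3
  refine ⟨?_, by omega, by omega⟩
  have h1 : 2 * L * (k - 1) ≤ 2 * (k * L) := by
    rw [mul_assoc, mul_comm L]
    exact Nat.mul_le_mul_left _ (Nat.mul_le_mul_right _ (by omega))
  have h2 : (b + 1) * (D + 1) ≤ k * (D + 1) := Nat.mul_le_mul_right _ (by omega)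
  rw [mul_add k D 1, mul_one] at h2
  omega

end Numerics

/-- Size and excess are measured against |W|, which suppression leaves unchanged, so these
hypotheses pass through the induction. -/
theorem exists_packing_of_sparse {W : Type*} [Fintype W] {H : SimpleGraph W} {k h L : ℕ}
    (hH : PathFree H k) (hk : 2 ≤ k) (hh : h = k / 2)
    (hN : 3424 * k ^ 4 ≤ Fintype.card W) (hLN : 144 * k ^ 2 * L ≤ Fintype.card W) (w : W)
    (hw : (nbrs H univ w).card + 1 ≤ h ∨
      ((nbrs H univ w).card ≤ k - 2 ∧ ∀ x, (nbrs H univ x).card ≤ k - 2))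
    (n : ℕ) : ∀ {V : Type*} [Fintype V] {G : SimpleGraph V}, Fintype.card V = n → 3 ≤ n →
      CutConnected G → ∑ x, (nbrs G univ x).card ≤ 2 * Fintype.card V + 2 * L →
      Fintype.card V + h ≤ Fintype.card W + 1 →
      (∀ c, ∃ I : Finset V, (∀ x ∈ I, ∀ y ∈ I, ¬ G.Adj x y) ∧
        (∀ x ∈ I, x ≠ c ∧ ¬ G.Adj c x) ∧
        (nbrs H univ w).card + Fintype.card V ≤ I.card + Fintype.card W) →
      ∃ ψ : V → W, IsPacking G H univ ψ := by
  induction n with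
  | zero =>
    intro V _ G hV h3
    omega
  | succ n ih =>
    intro V _ G hV h3 hG hL hspare hI
    -- Length 4k suffices for lengthening, which asks for 4h + 2k.
    rcases hG.exists_isSuspended_or_card_le (by omega) (q := 4 * k) (by omega) hL with ⟨p, hp⟩ | hs
    · have hc := card_suppress p
      have hq := hp.le_card
      have hsum := hp.sum_nbrs_suppress_le (by omega)
      obtain ⟨φ, hφ⟩ := ih (G := suppress G p) (by omega) (by omega)
        (hp.cutConnected_suppress (by omega) hG) (by omega) (by omega) (fun c => by
          -- The suspended path alone supplies at least 2k-4 ≥ k-2 independent vertices, so nothing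
          -- about α' has to be inherited from `G`.
          obtain ⟨I, h1, h2, h3⟩ := hp.exists_independent (by omega) c
          exact ⟨I, h1, h2, by omega⟩)
      exact hp.exists_packing_of_suppress hH hk (by omega) (by omega) (by omega) hspare hφ
    · set N := Fintype.card W with hNdef
      have hpos : 0 < 36 * k * (k + 2) := by positivity
      have hD1 : 36 * k * (k + 2) * (N / (36 * k * (k + 2))) ≤ N := Nat.mul_div_le _ _
      have hD2 : N < 36 * k * (k + 2) * (N / (36 * k * (k + 2)) + 1) :=
        Nat.lt_mul_div_succ _ hpos
      have hDk : k ≤ N / (36 * k * (k + 2)) := by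
        rw [Nat.le_div_iff_mul_le hpos]
        refine le_trans ?_ hN
        have h1 : k + 2 ≤ 2 * k := by omega
        have h2 : k ^ 3 ≤ k ^ 4 := Nat.pow_le_pow_right (by omega) (by omega)
        calc k * (36 * k * (k + 2)) = 36 * k ^ 2 * (k + 2) := by ring
          _ ≤ 36 * k ^ 2 * (2 * k) := Nat.mul_le_mul_left _ h1
          _ = 72 * k ^ 3 := by ring
          _ ≤ 3424 * k ^ 4 := by omega
      set D := N / (36 * k * (k + 2)) with hD
      have hβ := high_degree_bound hk hD2 (card_mul_le_sum_of_lt hH D)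
      obtain ⟨g1, g2, g3⟩ := greedy_bound hk (by omega) (by omega) hN hLN hD1 hβ (by omega)
        hs (h := h)
      refine exists_packing_of_large_reserve (h := h) (b := k - 1 - h) hH hk (by omega) hG
        (by omega) hL hspare w (D := D) (by omega) (fun c => ?_) g1 g2 g3
      rcases hw with hw | ⟨hw, hall⟩
      · exact ⟨∅, by simp, by simp, by simp, by simp, by rw [Finset.card_empty]; omega, by simp⟩
      · obtain ⟨I, h1, h2, h3⟩ := hI c
        -- Trim `I` to the number of neighbours of `w` not covered by the N - |V| spare vertices; it
        -- is at most k-1-h.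
        obtain ⟨J, hJ, hJc⟩ := Finset.exists_subset_card_eq
          (show (nbrs H univ w).card + Fintype.card V - N ≤ I.card by omega)
        refine ⟨J, fun x hx y hy => h1 x (hJ hx) y (hJ hy), fun x hx => h2 x (hJ hx), by omega,
          by omega, by omega, fun u _ x => ?_⟩
        have := hall x
        omega

/-! ### Upper bound -/

section Upper

theorem alphaPrime_le_indepNum {V : Type*} {G : SimpleGraph V} (c : V) :
    alphaPrime G ≤ (deleteClosedNbhd G c).indepNum :=
  ciInf_le' _ c

/-- If all degrees are at least h, every component has at most k-1 vertices. If k-1 does not divide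
the order, some component is smaller, which saves one in the degree of `w`. -/
theorem exists_good_vertex {W : Type*} [Fintype W] [Nonempty W] {H : SimpleGraph W} {k h n a : ℕ}
    (hH : PathFree H k) (hk : 2 ≤ k) (hh : h = k / 2)
    (hN : k - 2 + n ≤ a + Fintype.card W ∨
      (3 ≤ k ∧ k - 3 + n ≤ a + Fintype.card W ∧ ¬ (k - 1) ∣ Fintype.card W)) :
    ∃ w, (nbrs H univ w).card + 1 ≤ h ∨
      (((nbrs H univ w).card ≤ k - 2 ∧ ∀ x, (nbrs H univ x).card ≤ k - 2) ∧
        (nbrs H univ w).card + n ≤ a + Fintype.card W) := by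
  by_cases hsmall : ∃ w, (nbrs H univ w).card + 1 ≤ h
  · exact hsmall.imp (fun w hw => Or.inl hw)
  push Not at hsmall
  set U : W → Finset W := fun v => univ.filter (fun x => H.Reachable v x) with hU
  have hmem : ∀ {v x}, x ∈ U v ↔ H.Reachable v x := by simp [hU]
  have hUc : ∀ v, (U v).card ≤ k - 1 := by
    intro v
    refine hH.card_le_of_min_degree (h := h) (by omega) ?_ ?_
    · rintro A hA ⟨a, ha⟩ hne
      obtain ⟨b, hb, hbA⟩ : ∃ b ∈ U v, b ∉ A := by
        by_contra hcon
        push Not at hcon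
        exact hne (Finset.Subset.antisymm hA hcon)
      obtain ⟨p⟩ := (hmem.1 (hA ha)).symm.trans (hmem.1 hb)
      obtain ⟨d, -, h1, h2⟩ := p.exists_boundary_dart (A : Set W) ha hbA
      exact ⟨d.fst, h1, d.snd, Finset.mem_sdiff.2
        ⟨hmem.2 ((hmem.1 (hA h1)).trans d.adj.reachable), h2⟩, d.adj⟩
    · intro x hx
      have h1 : nbrs H univ x ⊆ nbrs H (U v) x := by
        intro y hy
        have hxy := (mem_nbrs.1 hy).2
        exact mem_nbrs.2 ⟨hmem.2 ((hmem.1 hx).trans hxy.reachable), hxy⟩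
      have := Finset.card_le_card h1
      have := hsmall x
      omega
  have hdeg : ∀ v, (nbrs H univ v).card + 1 ≤ (U v).card := by
    intro v
    have h1 : nbrs H univ v ⊆ (U v).erase v := by
      intro y hy
      have hvy := (mem_nbrs.1 hy).2
      exact Finset.mem_erase.2 ⟨hvy.ne', hmem.2 hvy.reachable⟩
    have h2 : v ∈ U v := hmem.2 (SimpleGraph.Reachable.refl v)
    have := Finset.card_le_card h1
    have := Finset.card_erase_add_one h2
    omega
  have hall : ∀ v, (nbrs H univ v).card ≤ k - 2 := by
    intro v
    have := hdeg v
    have := hUc v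
    omega
  rcases hN with hN | ⟨hk3, hN, hdvd⟩
  · obtain ⟨w⟩ := ‹Nonempty W›
    refine ⟨w, Or.inr ⟨⟨hall w, hall⟩, ?_⟩⟩
    have := hall w
    omega
  · obtain ⟨w, hw⟩ : ∃ w, (U w).card ≠ k - 1 := by
      by_contra hcon
      push Not at hcon
      refine hdvd ?_
      rw [← Finset.card_univ, Finset.card_eq_sum_card_image U univ]
      refine Finset.dvd_sum (fun b hb => ?_)
      obtain ⟨v, -, rfl⟩ := Finset.mem_image.1 hb
      have : univ.filter (fun x => U x = U v) = U v := by
        ext x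
        rw [Finset.mem_filter, hmem]
        constructor
        · rintro ⟨-, h⟩
          have : x ∈ U v := h ▸ hmem.2 (SimpleGraph.Reachable.refl x)
          exact hmem.1 this
        · intro h
          refine ⟨Finset.mem_univ _, ?_⟩
          ext y
          rw [hmem, hmem]
          exact ⟨fun h' => h.trans h', fun h' => h.symm.trans h'⟩
      rw [this, hcon]
    refine ⟨w, Or.inr ⟨⟨hall w, hall⟩, ?_⟩⟩
    have := hdeg w
    have := hUc w
    omega

theorem exists_independent_of_alphaPrime {V : Type*} [Finite V] (G : SimpleGraph V) (c : V) :
    ∃ I : Finset V, (∀ x ∈ I, ∀ y ∈ I, ¬ G.Adj x y) ∧ (∀ x ∈ I, x ≠ c ∧ ¬ G.Adj c x) ∧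
      alphaPrime G ≤ I.card := by
  obtain ⟨s, hs⟩ := (deleteClosedNbhd G c).exists_isNIndepSet_indepNum
  refine ⟨s.map (Function.Embedding.subtype _), ?_, ?_, ?_⟩
  · intro x hx y hy hxy
    obtain ⟨x, hx', rfl⟩ := Finset.mem_map.1 hx
    obtain ⟨y, hy', rfl⟩ := Finset.mem_map.1 hy
    exact hs.isIndepSet hx' hy' (fun h => hxy.ne (congrArg _ h)) hxy
  · intro x hx
    obtain ⟨x, -, rfl⟩ := Finset.mem_map.1 hx
    exact x.2
  · rw [Finset.card_map, hs.card_eq]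
    exact alphaPrime_le_indepNum c

variable {V : Type*} [Fintype V] {G : SimpleGraph V}

theorem sum_card_nbrs_eq (G : SimpleGraph V) :
    ∑ v, (nbrs G univ v).card = 2 * G.edgeSet.ncard := by
  rw [Set.ncard_eq_toFinset_card', ← SimpleGraph.edgeFinset, ←
    SimpleGraph.sum_degrees_eq_twice_card_edges]
  refine Finset.sum_congr rfl (fun v _ => ?_)
  rw [← SimpleGraph.card_neighborFinset_eq_degree, SimpleGraph.neighborFinset_eq_filter]
  rfl

theorem mem_ramseySet_of_le {n k h L N : ℕ} (hG : G.Connected) (hV : Fintype.card V = n)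
    (hk : 2 ≤ k) (hh : h = k / 2) (hn : 3424 * k ^ 4 ≤ n) (hL : 144 * k ^ 2 * L ≤ n)
    (hedges : G.edgeSet.ncard ≤ n + L) (h1 : n + h ≤ N + 1)
    (h2 : k - 2 + n ≤ alphaPrime G + N ∨
      (3 ≤ k ∧ k - 3 + n ≤ alphaPrime G + N ∧ ¬ (k - 1) ∣ N)) :
    N ∈ ramseySet G (SimpleGraph.pathGraph k) := by
  have hk4 : 0 < k ^ 4 := by positivity
  refine ⟨by omega, fun F => ?_⟩
  by_contra hcon
  rw [not_or] at hcon
  have hH : PathFree Fᶜ k := fun U f hf => hcon.2 hf.isContained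
  have : Nonempty (Fin N) := ⟨⟨0, by omega⟩⟩
  have hN : Fintype.card (Fin N) = N := Fintype.card_fin N
  obtain ⟨w, hw⟩ := exists_good_vertex (n := n) (a := alphaPrime G) hH hk hh (by rwa [hN])
  obtain ⟨ψ, hψ⟩ := exists_packing_of_sparse hH hk hh (by omega) (L := L) (by omega) w
    (hw.imp_right (fun h => h.1)) n hV (by omega) (cutConnected_of_connected hG)
    (by rw [sum_card_nbrs_eq]; omega) (by omega) (fun c => by
      rcases hw with hw | hw
      · exact ⟨∅, by simp, by simp, by rw [Finset.card_empty]; omega⟩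
      · obtain ⟨I, i1, i2, i3⟩ := exists_independent_of_alphaPrime G c
        exact ⟨I, i1, i2, by omega⟩)
  refine hcon.1 ⟨⟨⟨ψ, fun {a b} hab => ?_⟩, fun a b hab =>
    hψ.inj a (Finset.mem_univ _) b (Finset.mem_univ _) hab⟩⟩
  have h3 := hψ.sep a (Finset.mem_univ _) b (Finset.mem_univ _) hab
  rw [SimpleGraph.compl_adj] at h3
  by_contra hF
  exact h3 ⟨fun h => hab.ne (hψ.inj a (Finset.mem_univ _) b (Finset.mem_univ _) h), hF⟩

end Upper

/-! ### Lower bound constructions -/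

section Lower

theorem ramseySet_upward {V W : Type*} {H₁ : SimpleGraph V} {H₂ : SimpleGraph W} {M N : ℕ}
    (hM : M ∈ ramseySet H₁ H₂) (h : M ≤ N) : N ∈ ramseySet H₁ H₂ := by
  refine ⟨lt_of_lt_of_le hM.1 h, fun F => ?_⟩
  have hinj : Function.Injective (Fin.castLE h) := Fin.castLE_injective h
  have h1 : (F.comap (Fin.castLE h)).IsContained F := ⟨⟨⟨Fin.castLE h, fun hab => hab⟩, hinj⟩⟩
  have h2 : (F.comap (Fin.castLE h))ᶜ.IsContained Fᶜ :=
    ⟨⟨⟨Fin.castLE h, fun {a b} hab => ⟨fun h' => hab.1 (hinj h'), hab.2⟩⟩, hinj⟩⟩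
  exact (hM.2 (F.comap (Fin.castLE h))).imp (fun h' => h'.trans h1) (fun h' => h'.trans h2)

variable {V : Type*} [Fintype V] {G : SimpleGraph V}

/-- The host is the disjoint union of cliques on n-1 and h-1 vertices. -/
theorem notMem_ramseySet_of_two_cliques {n k h : ℕ} (hG : G.Connected)
    (hV : Fintype.card V = n) (hh : h = k / 2) (h0 : 0 < h) (hn : k ≤ n) :
    n + h - 2 ∉ ramseySet G (SimpleGraph.pathGraph k) := by
  intro hmem
  let F : SimpleGraph (Fin (n + h - 2)) :=
    { Adj := fun a b => a ≠ b ∧ (a.1 < n - 1 ↔ b.1 < n - 1)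
      symm := ⟨fun _ _ hab => ⟨hab.1.symm, hab.2.symm⟩⟩
      loopless := ⟨fun _ hab => hab.1 rfl⟩ }
  rcases hmem.2 F with ⟨⟨f⟩⟩ | ⟨⟨g⟩⟩
  · have hadj : ∀ u v, G.Adj u v → ((f u).1 < n - 1 ↔ (f v).1 < n - 1) :=
      fun u v huv => (f.toHom.map_adj huv).2
    have hinj : Function.Injective (fun v => (f v).1) :=
      fun a b hab => f.injective (Fin.ext hab)
    set A : Finset V := univ.filter (fun v => (f v).1 < n - 1) with hA
    by_cases hAu : A = univ
    · have h1 : Fintype.card V ≤ (Finset.range (n - 1)).card :=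
        Finset.card_le_card_of_injOn (s := univ) (fun v => (f v).1) (fun v _ => by
          have : v ∈ A := by rw [hAu]; exact Finset.mem_univ _
          exact Finset.mem_coe.2 (Finset.mem_range.2 (Finset.mem_filter.1 this).2)) hinj.injOn
      rw [Finset.card_range] at h1
      omega
    · rcases A.eq_empty_or_nonempty with he | hne
      · have h1 : Fintype.card V ≤ (Finset.Ico (n - 1) (n + h - 2)).card :=
          Finset.card_le_card_of_injOn (s := univ) (fun v => (f v).1) (fun v _ => by
            have : v ∉ A := by rw [he]; exact Finset.notMem_empty _
            rw [hA, Finset.mem_filter] at this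
            have h2 := (f v).2
            refine Finset.mem_coe.2 (Finset.mem_Ico.2 ⟨?_, h2⟩)
            simpa using this) hinj.injOn
        rw [Nat.card_Ico] at h1
        omega
      · obtain ⟨a, ha, x, hx, hax⟩ := cutConnected_of_connected hG A hne hAu
        refine hx (Finset.mem_filter.2 ⟨Finset.mem_univ _, ?_⟩)
        exact (hadj a x hax).1 (Finset.mem_filter.1 ha).2
  · have hstep : ∀ i (hi : i + 1 < k), (g ⟨i, by omega⟩).1 < n - 1 →
        ¬ (g ⟨i + 1, hi⟩).1 < n - 1 := by
      intro i hi h1 h2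
      have h3 : Fᶜ.Adj (g ⟨i, by omega⟩) (g ⟨i + 1, hi⟩) :=
        g.toHom.map_adj (SimpleGraph.pathGraph_adj.2 (Or.inl rfl))
      exact h3.2 ⟨h3.1, by simp [h1, h2]⟩
    -- Each of the h pairs of consecutive path vertices meets the clique on h-1 vertices.
    have hex : ∀ j : Fin h, ∃ i : Fin k, i.1 / 2 = j.1 ∧ ¬ (g i).1 < n - 1 := by
      intro j
      have hj := j.2
      by_cases h1 : (g ⟨2 * j.1, by omega⟩).1 < n - 1
      · refine ⟨⟨2 * j.1 + 1, by omega⟩, ?_, hstep _ _ h1⟩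
        change (2 * j.1 + 1) / 2 = j.1
        omega
      · refine ⟨⟨2 * j.1, by omega⟩, ?_, h1⟩
        change (2 * j.1) / 2 = j.1
        omega
    choose e he1 he2 using hex
    have h1 : Fintype.card (Fin h) ≤ (Finset.Ico (n - 1) (n + h - 2)).card :=
      Finset.card_le_card_of_injOn (s := univ) (fun j => (g (e j)).1) (fun j _ => by
        have h2 := (g (e j)).2
        have h3 := he2 j
        exact Finset.mem_coe.2 (Finset.mem_Ico.2 ⟨not_lt.1 h3, h2⟩)) (fun a _ b _ hab => by
        have h2 : e a = e b := g.injective (Fin.ext hab)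
        rw [Fin.ext_iff, ← he1 a, ← he1 b, h2])
    rw [Fintype.card_fin, Nat.card_Ico] at h1
    omega

/-- The residue classes modulo m are the parts; `h1` makes each at least t in size, `h2` at most
k-1. -/
theorem notMem_ramseySet_of_multipartite {n k m t N : ℕ} [Nonempty V]
    (hV : Fintype.card V = n) (hk : 2 ≤ k) (hm : 0 < m) (h1 : m * t ≤ N) (h2 : N ≤ m * (k - 1))
    (h3 : N + alphaPrime G + 2 ≤ n + t) : N ∉ ramseySet G (SimpleGraph.pathGraph k) := by
  intro hmem
  let F : SimpleGraph (Fin N) :=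
    { Adj := fun a b => a.1 % m ≠ b.1 % m
      symm := ⟨fun _ _ hab => hab.symm⟩
      loopless := ⟨fun _ hab => hab rfl⟩ }
  rcases hmem.2 F with ⟨⟨f⟩⟩ | ⟨⟨g⟩⟩
  · obtain ⟨c, hc⟩ : ∃ c, (deleteClosedNbhd G c).indepNum = alphaPrime G :=
      Set.mem_range.1 (ciInf_mem (fun v => (deleteClosedNbhd G v).indepNum))
    have hsep : ∀ u v, (f u).1 % m = (f v).1 % m → ¬ G.Adj u v :=
      fun u v huv hadj => (f.toHom.map_adj hadj : (f u).1 % m ≠ (f v).1 % m) huv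
    set T : Finset (Fin N) := univ.filter (fun x => x.1 % m = (f c).1 % m) with hT
    have hTc : t ≤ T.card := by
      rw [← Fintype.card_fin t]
      have hlt := Nat.mod_lt (f c).1 hm
      have hb : ∀ j : Fin t, (f c).1 % m + m * j.1 < N := by
        intro j
        have : m * (j.1 + 1) ≤ m * t := Nat.mul_le_mul_left _ j.2
        rw [mul_add, mul_one] at this
        omega
      refine Finset.card_le_card_of_injOn (s := univ)
        (fun j : Fin t => (⟨(f c).1 % m + m * j.1, hb j⟩ : Fin N)) (fun j _ => ?_) ?_
      · refine Finset.mem_coe.2 (Finset.mem_filter.2 ⟨Finset.mem_univ _, ?_⟩)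
        simp
      · intro i _ j _ hij
        have : (f c).1 % m + m * i.1 = (f c).1 % m + m * j.1 := congrArg Fin.val hij
        exact Fin.ext (Nat.eq_of_mul_eq_mul_left hm (by omega))
    set I : Finset V := univ.filter (fun v => v ≠ c ∧ f v ∈ T) with hI
    have hmemT : ∀ {v}, f v ∈ T → (f v).1 % m = (f c).1 % m :=
      fun h => (Finset.mem_filter.1 h).2
    -- A vertex of the part is the image of `c`, an image of `I`, or one of the N-n vertices missed
    -- by the copy.
    have hIc : T.card ≤ I.card + 1 + (N - n) := by
      have hsub : T ⊆ insert (f c) (I.image f) ∪ (univ \ univ.image f) := by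
        intro x hx
        by_cases hxf : ∃ v, f v = x
        · obtain ⟨v, rfl⟩ := hxf
          refine Finset.mem_union_left _ ?_
          by_cases hvc : v = c
          · rw [hvc]
            exact Finset.mem_insert_self _ _
          · exact Finset.mem_insert_of_mem (Finset.mem_image.2
              ⟨v, Finset.mem_filter.2 ⟨Finset.mem_univ _, hvc, hx⟩, rfl⟩)
        · refine Finset.mem_union_right _ (Finset.mem_sdiff.2 ⟨Finset.mem_univ _, ?_⟩)
          simpa using hxf
      have e1 := (Finset.card_le_card hsub).trans (Finset.card_union_le _ _)
      have e2 := Finset.card_insert_le (f c) (I.image f)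
      have e3 := Finset.card_image_le (s := I) (f := f)
      have e4 : (univ.image f).card = n := by
        have := Finset.card_image_of_injective univ (f := fun v => f v)
          (fun _ _ h => f.injective h)
        rwa [Finset.card_univ, hV] at this
      have e5 := Finset.card_sdiff_add_card_eq_card (Finset.subset_univ (univ.image f))
      rw [Finset.card_univ, Fintype.card_fin] at e5
      omega
    have hle : n ≤ N := by
      rw [← hV, ← Fintype.card_fin N]
      exact Fintype.card_le_of_injective f f.injective
    have hIα : I.card ≤ alphaPrime G := by
      have hprop : ∀ v ∈ I, v ∈ {w : V | w ≠ c ∧ ¬ G.Adj c w} := by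
        intro v hv
        have hv' := (Finset.mem_filter.1 hv).2
        exact ⟨hv'.1, hsep c v (hmemT hv'.2).symm⟩
      have hcard : (I.subtype (fun v => v ∈ {w : V | w ≠ c ∧ ¬ G.Adj c w})).card = I.card := by
        rw [Finset.card_subtype, Finset.filter_true_of_mem hprop]
      rw [← hc, ← hcard]
      refine SimpleGraph.IsIndepSet.card_le_indepNum (fun x hx y hy _ => ?_)
      have hx' := (Finset.mem_filter.1 (Finset.mem_subtype.1 hx)).2
      have hy' := (Finset.mem_filter.1 (Finset.mem_subtype.1 hy)).2
      exact hsep _ _ ((hmemT hx'.2).trans (hmemT hy'.2).symm)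
    omega
  · have hmod : ∀ i (hi : i < k), (g ⟨i, hi⟩).1 % m = (g ⟨0, by omega⟩).1 % m := by
      intro i
      induction i with
      | zero => exact fun _ => rfl
      | succ i ih =>
        intro hi
        rw [← ih (by omega)]
        have h4 : Fᶜ.Adj (g ⟨i, by omega⟩) (g ⟨i + 1, hi⟩) :=
          g.toHom.map_adj (SimpleGraph.pathGraph_adj.2 (Or.inl rfl))
        exact (not_not.1 h4.2).symm
    have h4 : Fintype.card (Fin k) ≤ (Finset.range (k - 1)).card := by
      refine Finset.card_le_card_of_injOn (s := univ) (fun i => (g i).1 / m) (fun i _ => ?_) ?_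
      · refine Finset.mem_coe.2 (Finset.mem_range.2 (Nat.div_lt_of_lt_mul ?_))
        exact lt_of_lt_of_le (g i).2 h2
      · intro i _ j _ hij
        have e1 : (g i).1 / m = (g j).1 / m := hij
        have e2 : (g i).1 % m = (g j).1 % m := (hmod i.1 i.2).trans (hmod j.1 j.2).symm
        have e3 : (g i).1 = (g j).1 := by
          rw [← Nat.div_add_mod (g i).1 m, e1, e2, Nat.div_add_mod]
        exact g.injective (Fin.ext e3)
    rw [Fintype.card_fin, Finset.card_range] at h4
    omega

theorem ramseyNumber_eq {V W : Type*} {H₁ : SimpleGraph V} {H₂ : SimpleGraph W} {N : ℕ}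
    (h1 : N ∈ ramseySet H₁ H₂) (h2 : N - 1 ∉ ramseySet H₁ H₂) : ramseyNumber H₁ H₂ = N := by
  refine le_antisymm (Nat.sInf_le h1) (le_csInf ⟨N, h1⟩ (fun M hM => ?_))
  by_contra hlt
  exact h2 (ramseySet_upward hM (by omega))

end Lower

/-! ### The excess in integers, and evaluation of the formula -/

theorem excess_bound {e n k : ℕ} (hk : 2 ≤ k)
    (h : (e : ℝ) ≤ (1 + 1 / (144 * (k : ℝ) ^ 2)) * (n : ℝ)) : 144 * k ^ 2 * (e - n) ≤ n := by
  rcases le_total e n with hle | hle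
  · rw [Nat.sub_eq_zero_of_le hle, mul_zero]
    exact Nat.zero_le _
  have hk0 : (0 : ℝ) < 144 * (k : ℝ) ^ 2 := by positivity
  have h1 : (e : ℝ) - n ≤ n / (144 * (k : ℝ) ^ 2) := by
    have : (1 + 1 / (144 * (k : ℝ) ^ 2)) * (n : ℝ) = n + n / (144 * (k : ℝ) ^ 2) := by ring
    linarith
  rw [le_div_iff₀ hk0] at h1
  have h2 : ((144 * k ^ 2 * (e - n) : ℕ) : ℝ) ≤ (n : ℝ) := by
    push_cast [Nat.cast_sub hle]
    linarith
  exact_mod_cast h2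

end
end SparseRamsey

theorem mainTheorem1 {V : Type*} [Fintype V] (G : SimpleGraph V) (hG : G.Connected)
    (n k : ℕ) (hV : Fintype.card V = n) (hk : 2 ≤ k) (hn : 3424 * k ^ 4 ≤ n)
    (hedges : (G.edgeSet.ncard : ℝ) ≤ (1 + 1 / (144 * (k : ℝ) ^ 2)) * (n : ℝ)) :
    (SparseRamsey.ramseyNumber G (SimpleGraph.pathGraph k) : ℤ) =
      max ((n : ℤ) + ((k / 2 : ℕ) : ℤ) - 1)
        ((n : ℤ) + k - 2 - SparseRamsey.alphaPrime G -
          SparseRamsey.gammaTerm n k (SparseRamsey.alphaPrime G)) := by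
  have hL := SparseRamsey.excess_bound hk hedges
  obtain ⟨h, hh⟩ : ∃ h, h = k / 2 := ⟨_, rfl⟩
  obtain ⟨a, ha⟩ : ∃ a, SparseRamsey.alphaPrime G = a := ⟨_, rfl⟩
  rw [← hh, ha]
  have hkn : 3424 * k ≤ n :=
    le_trans (Nat.mul_le_mul_left _ (Nat.le_self_pow (by omega) k)) hn
  have hkn2 : k ^ 2 ≤ n := by
    have : k ^ 2 ≤ k ^ 4 := Nat.pow_le_pow_right (by omega) (by omega)
    omega
  have : Nonempty V := hG.nonempty
  have hup : ∀ N : ℕ, n + h ≤ N + 1 → (k - 2 + n ≤ a + N ∨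
      (3 ≤ k ∧ k - 3 + n ≤ a + N ∧ ¬ (k - 1) ∣ N)) →
      N ∈ SparseRamsey.ramseySet G (SimpleGraph.pathGraph k) := fun N h1 h2 =>
    SparseRamsey.mem_ramseySet_of_le hG hV hk hh hn hL (by omega) h1 (by rwa [ha])
  have hcast : ((k - 1 : ℕ) : ℤ) = (k : ℤ) - 1 := by omega
  obtain ⟨γ, hγ⟩ : ∃ γ, SparseRamsey.gammaTerm n k a = γ := ⟨_, rfl⟩
  have hγ' : (γ = 0 ∧ (k : ℤ) - 1 ∣ (n : ℤ) + k - 3 - a) ∨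
      (γ = 1 ∧ ¬ (k : ℤ) - 1 ∣ (n : ℤ) + k - 3 - a) := by
    rw [← hγ]
    unfold SparseRamsey.gammaTerm
    split_ifs with hd
    · exact Or.inl ⟨rfl, hd⟩
    · exact Or.inr ⟨rfl, hd⟩
  have hk3 : γ = 1 → 3 ≤ k := by
    intro h1
    by_contra hcon
    obtain rfl : k = 2 := by omega
    rcases hγ' with h | h
    · omega
    · exact h.2 (by norm_num)
  rw [hγ]
  rcases le_or_gt ((n : ℤ) + k - 2 - a - γ) ((n : ℤ) + h - 1) with hle | hgt
  · rw [max_eq_left hle]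
    have h1 : SparseRamsey.ramseyNumber G (SimpleGraph.pathGraph k) = n + h - 1 := by
      refine SparseRamsey.ramseyNumber_eq (hup _ (by omega) ?_) ?_
      · rcases hγ' with ⟨rfl, -⟩ | ⟨rfl, hd⟩
        · left
          omega
        -- In the first case n+h-1 equals n+k-3-a, exactly the number that k-1 does not divide.
        · rcases Nat.lt_or_ge (a + (n + h - 1)) (k - 2 + n) with hlt | hge
          · refine Or.inr ⟨hk3 rfl, by have := hk3 rfl; omega, fun hdvd => hd ?_⟩
            rw [← hcast, show (n : ℤ) + k - 3 - a = ((n + h - 1 : ℕ) : ℤ) by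
              have := hk3 rfl; omega]
            exact Int.natCast_dvd_natCast.2 hdvd
          · exact Or.inl hge
      · rw [show n + h - 1 - 1 = n + h - 2 by omega]
        exact SparseRamsey.notMem_ramseySet_of_two_cliques hG hV hh (by omega) (by omega)
    rw [h1]
    omega
  · rw [max_eq_right hgt.le]
    rcases hγ' with ⟨rfl, hd⟩ | ⟨rfl, hd⟩
    · have h1 : SparseRamsey.ramseyNumber G (SimpleGraph.pathGraph k) = n + k - 2 - a := by
        refine SparseRamsey.ramseyNumber_eq (hup _ (by omega) (Or.inl (by omega))) ?_
        rw [← hcast, show (n : ℤ) + k - 3 - a = ((n + k - 2 - a - 1 : ℕ) : ℤ) by omega,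
          Int.natCast_dvd_natCast] at hd
        obtain ⟨m, hm⟩ := hd
        have hmc : m * (k - 1) = n + k - 2 - a - 1 := by rw [hm, mul_comm]
        have hm0 : 0 < m := by
          rcases Nat.eq_zero_or_pos m with rfl | h0
          · omega
          · exact h0
        exact SparseRamsey.notMem_ramseySet_of_multipartite (t := k - 1) hV hk hm0 hmc.le hmc.ge
          (by rw [ha]; omega)
      rw [h1]
      omega
    · have h3 := hk3 rfl
      have h1 : SparseRamsey.ramseyNumber G (SimpleGraph.pathGraph k) = n + k - 3 - a := by
        refine SparseRamsey.ramseyNumber_eq (hup _ (by omega) (Or.inr ⟨h3, by omega, fun hdvd => hd ?_⟩)) ?_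
        · rw [← hcast, show (n : ℤ) + k - 3 - a = ((n + k - 3 - a : ℕ) : ℤ) by omega]
          exact Int.natCast_dvd_natCast.2 hdvd
        · set N := n + k - 3 - a - 1 with hN
          -- With one part more than the quotient, parts of size k-1 cover N; a quotient of at least
          -- k-2 ensures that parts of size k-2 fit.
          have hq : k - 1 ≤ N / (k - 1) := by
            rw [Nat.le_div_iff_mul_le (by omega)]
            have e1 : (k - 1) * (k - 1) + (k - 1) ≤ k ^ 2 := by
              obtain ⟨j, rfl⟩ : ∃ j, k = j + 1 := ⟨k - 1, by omega⟩
              rw [Nat.add_sub_cancel]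
              nlinarith
            omega
          have e2 := Nat.div_mul_le_self N (k - 1)
          have e3 := Nat.lt_div_mul_add (a := N) (b := k - 1) (by omega)
          refine SparseRamsey.notMem_ramseySet_of_multipartite (m := N / (k - 1) + 1) (t := k - 2) hV hk
            (Nat.succ_pos _) ?_ ?_ (by rw [ha]; omega)
          · have e4 : (N / (k - 1) + 1) * (k - 1) =
                (N / (k - 1) + 1) * (k - 2) + (N / (k - 1) + 1) := by
              rw [show k - 1 = k - 2 + 1 by omega]
              ring
            rw [add_mul _ _ (k - 1), one_mul] at e4
            omega
          · rw [add_mul, one_mul]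
            omega
      rw [h1]
      omega
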